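/- **Setting.** For $\tau$ in the upper half-plane let $\wp(z)=\wp(z|\tau)$ be the Weierstrass function of the lattice $2\pi i(\mathbb Z+\tau\mathbb Z)$, with $\wp'^2=4\wp^3-g_2\wp-g_3$. Let $\omega\in\mathbb C\setminus\{0\}$ and put $$u=\frac{g_2(\tau)}{4(2\omega)^4},\qquad v=-\frac{g_3(\tau)}{4(2\omega)^6},\qquad A(x)=x^3-ux-(1-v).$$ Consider the $SU(3)$ Seiberg–Witten curve $y^2=A(x)^2-1=(x^3-ux+v)(x^3-ux+v-2)$ with differential $\lambda=xA'(x)\,dx/y$. It is parametrised near its three small branch points by $x=\wp(z)/(2\omega)^2$ and $y=\frac{i\,\wp'(z)}{\sqrt2\,(2\omega)^3}\sqrt{1-\tfrac12P}$, where $P=x^3-ux+v=\frac{\wp'(z)^2}{4(2\omega)^6}$ and the root is the principal one for $|P|<2$. An $\mathfrak A$-cycle (resp. $\mathfrak B$-cycle) is a $C^1$ path in the $z$-plane, avoiding the lattice, from some $z_0$ to $z_0+2\pi i$ (resp. $z_0+2\pi i\tau$). It is called short if $0<|P|<2$ along it. For such cycles put $$A_n=\frac1{2\pi i}\oint_{\mathfrak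 A}\wp^n\,dz,\quad B_n=\frac1{2\pi i}\oint_{\mathfrak B}\wp^n\,dz,\qquad a=\frac1{2\pi i}\oint_{\mathfrak A}\lambda,\quad a_D=\frac1{2\pi i}\oint_{\mathfrak B}\lambda,$$ where $A_n,B_n$ are defined for all $n\ge0$ and all such cycles, and $a,a_D$ for short ones, through their images on the curve. **Theorem.** 1. $g_2=E_4/12$ and $g_3=-E_6/216$; the points $(x,y)$ above lie on the curve. 2. For all $\mathfrak A$- and $\mathfrak B$-cycles, $A_0=1$, $B_0=\tau$, and for $J=A$ and $J=B$ $$(8n-4)J_n=(2n-3)g_2J_{n-2}+(2n-4)g_3J_{n-3}\qquad(n\ge2),$$ the last term being absent for $n=2$. Let $K_n$ be the solution of this recursion with $K_0=1$, $K_1=0$, and let $L_n$ be such that $n\mapsto L_{n-1}$ is the solution with $L_{-1}=0$, $L_0=1$. Then for $n\ge1$ $$A_n=K_n+\tfrac1{12}E_2L_{n-1},\qquad B_n=\tau A_n+\tfrac1{2\pi i}L_{n-1},$$ and, for all $n\ge0$, $K_n$ and $L_n$ are modular forms for $SL_2(\mathbb Z)$ of weight $2n$, given by weighted-homogeneous polynomials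 in $E_4,E_6$ with rational coefficients. 3. For each $\tau$ there are $\mathfrak A$- and $\mathfrak B$-cycles along which $\wp'\ne0$, and for every such cycle, if $|\omega|$ is large enough, then $|u|+|v|<1$ and the cycle is short. Whenever $|u|+|v|<1$ and the cycles are short, their images are closed paths on the curve off its branch points, and, with $$c_{k\ell m}=\frac{\Gamma(k+\ell+m+\frac12)}{2^{k+3\ell+3m}\,k!\,\ell!\,m!}\,\frac{(-1)^{\ell+m}g_2^\ell g_3^m}{(2\omega)^{6(k+\ell+m)+5}},$$ the following triple series converge absolutely: $$a=-i\sqrt{\tfrac2\pi}\sum_{k,\ell,m\ge0}c_{k\ell m}\Big(3A_{3k+\ell+3}-\tfrac{g_2}4A_{3k+\ell+1}\Big),\qquad a_D=-i\sqrt{\tfrac2\pi}\sum_{k,\ell,m\ge0}c_{k\ell m}\Big(3B_{3k+\ell+3}-\tfrac{g_2}4B_{3k+\ell+1}\Big),$$ $$a_D-\tau a=\frac{-2}{(2\pi)^{3/2}}\sum_{k,\ell,m\ge0}c_{k\ell m}\Big(3L_{3k+\ell+2}-\tfrac{g_2}4L_{3k+\ell}\Big).$$ 4. The set of $(\tau,2\omega)$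 with $\omega\ne0$ and $|u|+|v|<1$ is open. On it the last series converges absolutely, and its sum $\Phi(\tau,2\omega)$ is holomorphic. The set is invariant under $(\tau,2\omega)\mapsto\big(\frac{\alpha\tau+\beta}{\gamma\tau+\delta},(\gamma\tau+\delta)2\omega\big)$ for $\begin{pmatrix}\alpha&\beta\\\gamma&\delta\end{pmatrix}\in SL_2(\mathbb Z)$, and there $$\Phi\Big(\tfrac{\alpha\tau+\beta}{\gamma\tau+\delta},(\gamma\tau+\delta)2\omega\Big)=(\gamma\tau+\delta)^{-1}\Phi(\tau,2\omega),$$ i.e. $a_D-\tau a$ is modular of weight $-1$ when $\omega$ is assigned weight $1$. -/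

import Mathlib

open scoped MatrixGroups UpperHalfPlane

noncomputable section

namespace SU3

/-! ## The genus two curve `y² = A(x)² - 1`, `A(x) = x³ - u x - u₀`, `u₀ = 1 - v`, and its periods -/

/-- The polynomial `A(x) = x³ - u x - u₀` with `u₀ = 1 - v`. -/
def swA (u v x : ℂ) : ℂ := x ^ 3 - u * x - (1 - v)

/-- The curve `y² = A(x)² - 1 = (x³ - u x + v) (x³ - u x + v - 2)` (its affine part). -/
def swCurve (u v : ℂ) : Set (ℂ × ℂ) := {p | p.2 ^ 2 = swA u v p.1 ^ 2 - 1}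

/-- `t ↦ (x t, y t)`, `0 ≤ t ≤ 1`, is a closed path on the affine curve that does not meet the
branch points (the points with `y = 0`). -/
structure IsClosedPath (u v : ℂ) (x y : ℝ → ℂ) : Prop where
  continuousOn_x : ContinuousOn x (Set.Icc 0 1)
  continuousOn_y : ContinuousOn y (Set.Icc 0 1)
  mem : ∀ t ∈ Set.Icc (0 : ℝ) 1, (x t, y t) ∈ swCurve u v
  y_ne : ∀ t ∈ Set.Icc (0 : ℝ) 1, y t ≠ 0
  x_end : x 1 = x 0
  y_end : y 1 = y 0

/-- `(1 / 2πi) ∮ λ`, `λ = x A'(x) dx / y`, along the path `t ↦ (x t, y t)`, `0 ≤ t ≤ 1`. -/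
def swPeriod (u v : ℂ) (x y : ℝ → ℂ) : ℂ :=
  (2 * Real.pi * Complex.I)⁻¹ *
    ∫ t in (0 : ℝ)..1, x t * deriv (swA u v) (x t) * deriv x t / y t

/-! ## The elliptic parametrisation -/

/-- The periods `2πi` and `2πiτ`. -/
def periods (τ : ℍ) : PeriodPair where
  ω₁ := 2 * Real.pi * Complex.I
  ω₂ := 2 * Real.pi * Complex.I * τ
  indep := by
    rw [LinearIndependent.pair_iff]
    intro s t h
    have hc : (2 * Real.pi * Complex.I : ℂ) ≠ 0 := Complex.two_pi_I_ne_zero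
    have h1 : (2 * Real.pi * Complex.I : ℂ) * ((s : ℂ) + t * (τ : ℂ)) = 0 := by
      rw [← h]; simp only [Complex.real_smul]; ring
    have h2 : (s : ℂ) + t * (τ : ℂ) = 0 := (mul_eq_zero.mp h1).resolve_left hc
    have him := congrArg Complex.im h2
    have hre := congrArg Complex.re h2
    have ht : t = 0 := by
      have : t * τ.im = 0 := by simpa using him
      exact (mul_eq_zero.mp this).resolve_right τ.im_ne_zero
    subst ht
    exact ⟨by simpa using hre, rfl⟩

/-- The Weierstrass function `℘(z|τ)` of the lattice `2πi (ℤ + τ ℤ)`. -/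
def wp (τ : ℍ) (z : ℂ) : ℂ := (periods τ).weierstrassP z

/-- Its derivative `℘'(z|τ)`. -/
def wp' (τ : ℍ) (z : ℂ) : ℂ := (periods τ).derivWeierstrassP z

/-- The invariant `g₂(τ)` in `℘'² = 4 ℘³ - g₂ ℘ - g₃`. -/
def g₂ (τ : ℍ) : ℂ := (periods τ).g₂

/-- The invariant `g₃(τ)` in `℘'² = 4 ℘³ - g₂ ℘ - g₃`. -/
def g₃ (τ : ℍ) : ℂ := (periods τ).g₃

/-- The modulus `u`, from `4 (2ω)⁴ u = g₂(τ)`; here and below `w` stands for `2ω`. -/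
def modU (τ : ℍ) (w : ℂ) : ℂ := g₂ τ / (4 * w ^ 4)

/-- The modulus `v`, from `-4 (2ω)⁶ v = g₃(τ)`. -/
def modV (τ : ℍ) (w : ℂ) : ℂ := -g₃ τ / (4 * w ^ 6)

/-- The coordinate `x = ℘(z|τ) / (2ω)²`. -/
def coordX (τ : ℍ) (w z : ℂ) : ℂ := wp τ z / w ^ 2

/-- `x³ - u x + v` at `x = ℘(z|τ) / (2ω)²`, the factor of `y²` that vanishes at the three small
branch points. -/
def smallFactor (τ : ℍ) (w z : ℂ) : ℂ :=
  coordX τ w z ^ 3 - modU τ w * coordX τ w z + modV τ w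

/-- The coordinate `y`. Since `y² = P (P - 2)` with `P = x³ - u x + v = ℘'(z|τ)² / (4 (2ω)⁶)`, it is
`y = i ℘'(z|τ) / (√2 (2ω)³) * √(1 - P / 2)`; the principal root is holomorphic for `|P| < 2`. -/
def coordY (τ : ℍ) (w z : ℂ) : ℂ :=
  Complex.I * wp' τ z / (Real.sqrt 2 * w ^ 3) * (1 - smallFactor τ w z / 2) ^ (1 / 2 : ℂ)

/-! ## Cycles -/

/-- `γ`, restricted to `[0, 1]`, is a deformation of the segment `[0, c]` that avoids the poles of
`℘`: a continuously differentiable path from some `z₀` to `z₀ + c` in the complement of the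
lattice. -/
structure IsCycle (τ : ℍ) (c : ℂ) (γ : ℝ → ℂ) : Prop where
  contDiff : ContDiff ℝ 1 γ
  end_eq : γ 1 = γ 0 + c
  avoids : ∀ t ∈ Set.Icc (0 : ℝ) 1, γ t ∉ (periods τ).lattice

/-- A deformation of the short cycle `𝔄 = [0, 2πi]`. -/
def IsACycle (τ : ℍ) (γ : ℝ → ℂ) : Prop := IsCycle τ (2 * Real.pi * Complex.I) γ

/-- A deformation of the short cycle `𝔅 = [0, 2πiτ]`. -/
def IsBCycle (τ : ℍ) (γ : ℝ → ℂ) : Prop := IsCycle τ (2 * Real.pi * Complex.I * τ) γ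

/-- The cycle stays near the three small branch points, `|x³ - u x + v| < 2`, without meeting
them. -/
def IsShort (τ : ℍ) (w : ℂ) (γ : ℝ → ℂ) : Prop :=
  ∀ t ∈ Set.Icc (0 : ℝ) 1, 0 < ‖smallFactor τ w (γ t)‖ ∧ ‖smallFactor τ w (γ t)‖ < 2

/-- `(1 / 2πi) ∮ ℘(z)ⁿ dz` along `γ`: this is `Aₙ` for an `𝔄`-cycle, `Bₙ` for a `𝔅`-cycle. -/
def cycleIntegral (τ : ℍ) (γ : ℝ → ℂ) (n : ℕ) : ℂ :=
  (2 * Real.pi * Complex.I)⁻¹ * ∫ t in (0 : ℝ)..1, wp τ (γ t) ^ n * deriv γ t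

/-- The period `(1 / 2πi) ∮ λ` along the image of `γ` on the curve: this is `a` for an `𝔄`-cycle,
`a_D` for a `𝔅`-cycle. -/
def shortPeriod (τ : ℍ) (w : ℂ) (γ : ℝ → ℂ) : ℂ :=
  swPeriod (modU τ w) (modV τ w) (fun t => coordX τ w (γ t)) (fun t => coordY τ w (γ t))

/-! ## The recursion -/

/-- `(8n - 4) Jₙ = (2n - 3) g₂ Jₙ₋₂ + (2n - 4) g₃ Jₙ₋₃` for all `n ≥ 2`; the last term is absent for
`n = 2`, where its coefficient vanishes. -/
def Recursion (g h : ℂ) (J : ℕ → ℂ) : Prop :=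
  12 * J 2 = g * J 0 ∧
    ∀ n : ℕ, 3 ≤ n →
      (8 * n - 4) * J n = (2 * n - 3) * g * J (n - 2) + (2 * n - 4) * h * J (n - 3)

/-- The solution of the recursion, with `g = g₂`, `h = g₃`, for given values `J₀`, `J₁`. -/
def recSol (g h J₀ J₁ : ℂ) : ℕ → ℂ
  | 0 => J₀
  | 1 => J₁
  | 2 => g * J₀ / 12
  | n + 3 =>
    ((2 * (n + 3) - 3) * g * recSol g h J₀ J₁ (n + 1) +
      (2 * (n + 3) - 4) * h * recSol g h J₀ J₁ n) / (8 * (n + 3) - 4)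

/-- `Kₙ`: the solution of the recursion with `K₀ = 1`, `K₁ = 0`. -/
def K (n : ℕ) (τ : ℍ) : ℂ := recSol (g₂ τ) (g₃ τ) 1 0 n

/-- `Lₙ`: here `n ↦ Lₙ₋₁` is the solution of the recursion with `L₋₁ = 0`, `L₀ = 1`. -/
def L (n : ℕ) (τ : ℍ) : ℂ := recSol (g₂ τ) (g₃ τ) 0 1 (n + 1)

/-! ## The triple series -/

/-- `Γ(k+ℓ+m+1/2) / (2^(k+3ℓ+3m) k! ℓ! m!) * (-1)^(ℓ+m) g₂^ℓ g₃^m / (2ω)^(6(k+ℓ+m)+5)`. -/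
def coeff (τ : ℍ) (w : ℂ) (k l m : ℕ) : ℂ :=
  (Real.Gamma (k + l + m + 1 / 2) : ℂ) /
      (2 ^ (k + 3 * l + 3 * m) * (k.factorial : ℂ) * (l.factorial : ℂ) * (m.factorial : ℂ)) *
    ((-1) ^ (l + m) * g₂ τ ^ l * g₃ τ ^ m / w ^ (6 * (k + l + m) + 5))

/-- The general term of the series for `a` (with `J = A`) and for `a_D` (with `J = B`). -/
def periodTerm (τ : ℍ) (w : ℂ) (J : ℕ → ℂ) (p : ℕ × ℕ × ℕ) : ℂ :=
  -Complex.I * (Real.sqrt (2 / Real.pi) : ℂ) * coeff τ w p.1 p.2.1 p.2.2 *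
    (3 * J (3 * p.1 + p.2.1 + 3) - g₂ τ / 4 * J (3 * p.1 + p.2.1 + 1))

/-- The general term of the series for `a_D - τ a`. -/
def modularTerm (τ : ℍ) (w : ℂ) (p : ℕ × ℕ × ℕ) : ℂ :=
  ((-2 / (2 * Real.pi) ^ (3 / 2 : ℝ) : ℝ) : ℂ) * coeff τ w p.1 p.2.1 p.2.2 *
    (3 * L (3 * p.1 + p.2.1 + 2) τ - g₂ τ / 4 * L (3 * p.1 + p.2.1) τ)

/-- The sum of the series for `a_D - τ a`. -/
def modularSum (τ : ℍ) (w : ℂ) : ℂ := ∑' p : ℕ × ℕ × ℕ, modularTerm τ w p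

/-- The domain `ω ≠ 0`, `|u| + |v| < 1` of pairs `(τ, 2ω)`. -/
def InDomain (τ : ℍ) (w : ℂ) : Prop := w ≠ 0 ∧ ‖modU τ w‖ + ‖modV τ w‖ < 1

/-- The same domain as a subset of `ℂ × ℂ`. -/
def domain : Set (ℂ × ℂ) := {p | ∃ h : 0 < p.1.im, InDomain ⟨p.1, h⟩ p.2}

end SU3

end

/-!
By the differential equation of `℘`, the differential of the elliptic function `℘ⁿ⁺¹ ℘'` is a
combination of `℘ⁿ⁺³ dz`, `℘ⁿ⁺¹ dz` and `℘ⁿ dz`, and its integral along a cycle vanishes: this is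
the recursion, so the cycle integrals are determined by those of `1` and `℘`. Integrating the
lattice sum of `℘` term by term, along rows of the lattice parallel to the cycle, the rows
telescope. The integral of `℘` is thus a multiple of `G₂(τ)` along an `𝔄`-cycle and of `G₂(-1/τ)`
along a `𝔅`-cycle, and the anomaly of `G₂` under `τ ↦ -1/τ` is Legendre's relation.

Along a short cycle `λ` is a constant multiple of `(1 - P / 2)^(-1/2) (3 x³ - u x) dz`. Expanding
first in powers of `P / 2 = x³ / 2 - u x / 2 + v / 2`, uniformly on the cycle, and then
trinomially gives the triple series, grouped by `k + ℓ + m`. It converges absolutely: in the units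
`2ω = 1` the solutions of the recursion are bounded as soon as `|u| + |v| ≤ 1`, and the trinomial
series of `1/2 + |u|/2 + |v|/2 < 1` is a geometric series.

Finally `Lₙ(τ) = (2ω)²ⁿ` times a polynomial in `(u, v)`, so the series for `a_D - τ a` is
`(2ω)⁻¹` times a holomorphic function of `(u, v)`, while `u` and `v` are modular of weight `0`.
-/

namespace SU3

/-! ## The invariants as Eisenstein series -/

lemma latticeEquivProd_symm_periods (τ : ℍ) (p : ℤ × ℤ) :
    (((periods τ).latticeEquivProd.symm p : (periods τ).lattice) : ℂ) =
      2 * Real.pi * Complex.I * (p.2 * τ + p.1) := by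
  rw [PeriodPair.latticeEquiv_symm_apply]
  simp only [periods]
  ring

lemma G_periods (τ : ℍ) {k : ℕ} (hk : 3 ≤ k) :
    (periods τ).G k = ((2 * Real.pi * Complex.I) ^ k)⁻¹ *
      (2 * riemannZeta k * ModularForm.E hk τ) := by
  have hE : ModularForm.E hk τ =
      (1 / 2 : ℂ) • EisensteinSeries.eisensteinSeriesSIF (N := 1) 0 k τ := rfl
  have h_half : (2 : ℂ) * riemannZeta k * (1 / 2 * eisensteinSeries (N := 1) 0 k τ) =
      riemannZeta k * eisensteinSeries (N := 1) 0 k τ := by ring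
  rw [hE, EisensteinSeries.eisensteinSeriesSIF_apply, smul_eq_mul, h_half,
    ← tsum_eisSummand_eq_riemannZeta_mul_eisensteinSeries hk, ← tsum_mul_left, PeriodPair.G,
    ← (periods τ).latticeEquivProd.symm.toEquiv.tsum_eq,
    ← ((finTwoArrowEquiv ℤ).trans (Equiv.prodComm ℤ ℤ)).tsum_eq]
  refine tsum_congr fun v => ?_
  change ((((periods τ).latticeEquivProd.symm (v 1, v 0) : (periods τ).lattice) : ℂ) ^ k)⁻¹ = _
  rw [latticeEquivProd_symm_periods, mul_pow, mul_inv, EisensteinSeries.eisSummand, zpow_neg,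
    zpow_natCast]

lemma bernoulli_six : bernoulli 6 = 1 / 42 := by
  have h5 : bernoulli' 5 = 0 := by
    rw [bernoulli'_def]; norm_num [Finset.sum_range_succ, Nat.choose]
  rw [bernoulli_eq_bernoulli'_of_ne_one (by norm_num), bernoulli'_def]
  norm_num [Finset.sum_range_succ, Nat.choose, h5]

lemma riemannZeta_six : riemannZeta 6 = Real.pi ^ 6 / 945 := by
  have h := riemannZeta_two_mul_nat (k := 3) (by norm_num)
  norm_num [bernoulli_six, Nat.factorial] at h
  rw [h]
  ring

lemma g₂_eq (τ : ℍ) : g₂ τ = ModularForm.E₄ τ / 12 := by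
  have hζ : riemannZeta (4 : ℕ) = Real.pi ^ 4 / 90 := by exact_mod_cast riemannZeta_four
  have hπ : (Real.pi : ℂ) ≠ 0 := by exact_mod_cast Real.pi_ne_zero
  rw [g₂, PeriodPair.g₂, G_periods τ (by norm_num : 3 ≤ 4), hζ, mul_pow, mul_pow,
    Complex.I_pow_four]
  field_simp
  ring

lemma g₃_eq (τ : ℍ) : g₃ τ = -ModularForm.E₆ τ / 216 := by
  have hζ : riemannZeta (6 : ℕ) = Real.pi ^ 6 / 945 := by exact_mod_cast riemannZeta_six
  have hπ : (Real.pi : ℂ) ≠ 0 := by exact_mod_cast Real.pi_ne_zero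
  have hI : Complex.I ^ 6 = -1 := by
    rw [show 6 = 4 + 2 by rfl, pow_add, Complex.I_pow_four, Complex.I_sq, one_mul]
  rw [g₃, PeriodPair.g₃, G_periods τ (by norm_num : 3 ≤ 6), hζ, mul_pow, mul_pow, hI]
  field_simp
  ring

/-! ## The recursion -/

section Recursion

variable {g h : ℂ}

lemma two_mul_natCast_add_five_ne_zero (n : ℕ) : (2 * n + 5 : ℂ) ≠ 0 := by
  exact_mod_cast (show 2 * n + 5 ≠ 0 by omega)

lemma recSol_add_three (g h a b : ℂ) (n : ℕ) :
    recSol g h a b (n + 3) =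
      (2 * n + 3) / (4 * (2 * n + 5)) * (g * recSol g h a b (n + 1)) +
        (n + 1) / (2 * (2 * n + 5)) * (h * recSol g h a b n) := by
  have h5 := two_mul_natCast_add_five_ne_zero n
  rw [recSol, show 8 * ((n : ℂ) + 3) - 4 = 4 * (2 * n + 5) by ring]
  field_simp
  ring

lemma Recursion.eq_recSol {J : ℕ → ℂ} (hJ : Recursion g h J) :
    ∀ n, J n = recSol g h (J 0) (J 1) n
  | 0 => by rw [recSol]
  | 1 => by rw [recSol]
  | 2 => by rw [recSol, ← hJ.1]; ring
  | n + 3 => by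
    have h3 := hJ.2 (n + 3) (by omega)
    simp only [Nat.add_sub_cancel, show n + 3 - 2 = n + 1 by omega] at h3
    push_cast at h3
    have h5 := two_mul_natCast_add_five_ne_zero n
    rw [recSol_add_three, ← hJ.eq_recSol (n + 1), ← hJ.eq_recSol n]
    field_simp
    linear_combination 2 * h3

lemma recSol_eq_combination (g h a b : ℂ) :
    ∀ n, recSol g h a b n = a * recSol g h 1 0 n + b * recSol g h 0 1 n
  | 0 => by simp only [recSol]; ring
  | 1 => by simp only [recSol]; ring
  | 2 => by simp only [recSol]; ring
  | n + 3 => by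
    rw [recSol, recSol, recSol, recSol_eq_combination g h a b (n + 1),
      recSol_eq_combination g h a b n]
    ring

lemma recSol_scale (s g h a b : ℂ) :
    ∀ n, recSol (s ^ 4 * g) (s ^ 6 * h) a (s ^ 2 * b) n = s ^ (2 * n) * recSol g h a b n
  | 0 => by simp [recSol]
  | 1 => by simp [recSol]
  | 2 => by simp only [recSol]; ring
  | n + 3 => by
    rw [recSol, recSol, recSol_scale s g h a b (n + 1), recSol_scale s g h a b n]
    ring

lemma norm_recSol_le {u v : ℂ} (huv : ‖u‖ + ‖v‖ ≤ 1) (a b : ℂ) :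
    ∀ n, ‖recSol (4 * u) (-4 * v) a b n‖ ≤ max ‖a‖ ‖b‖
  | 0 => by rw [recSol]; exact le_max_left _ _
  | 1 => by rw [recSol]; exact le_max_right _ _
  | 2 => by
    have hu : ‖u‖ / 3 ≤ 1 := by linarith [norm_nonneg v, norm_nonneg u]
    calc ‖recSol (4 * u) (-4 * v) a b 2‖ = ‖u‖ / 3 * ‖a‖ := by
          rw [recSol, show 4 * u * a / 12 = u / 3 * a by ring, norm_mul, norm_div,
            Complex.norm_ofNat]
      _ ≤ 1 * max ‖a‖ ‖b‖ := by gcongr; exact le_max_left _ _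
      _ = max ‖a‖ ‖b‖ := one_mul _
  | n + 3 => by
    set M := max ‖a‖ ‖b‖
    have hM : 0 ≤ M := (norm_nonneg a).trans (le_max_left _ _)
    have h_eq : recSol (4 * u) (-4 * v) a b (n + 3) =
        (((2 * n + 3) / (2 * n + 5) : ℝ) : ℂ) * (u * recSol (4 * u) (-4 * v) a b (n + 1)) -
          (((2 * n + 2) / (2 * n + 5) : ℝ) : ℂ) * (v * recSol (4 * u) (-4 * v) a b n) := by
      have h5 := two_mul_natCast_add_five_ne_zero n
      rw [recSol_add_three]
      push_cast
      field_simp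
      ring
    have h_coeff {r s : ℝ} (hr : 0 ≤ r) (hs : 0 < s) (hrs : r ≤ s) {z : ℂ} :
        ‖((r / s : ℝ) : ℂ) * z‖ ≤ ‖z‖ := by
      rw [norm_mul, Complex.norm_of_nonneg (by positivity)]
      exact mul_le_of_le_one_left (norm_nonneg z) ((div_le_one hs).mpr hrs)
    calc ‖recSol (4 * u) (-4 * v) a b (n + 3)‖
        ≤ ‖u * recSol (4 * u) (-4 * v) a b (n + 1)‖ + ‖v * recSol (4 * u) (-4 * v) a b n‖ := by
          rw [h_eq]
          refine (norm_sub_le _ _).trans (add_le_add ?_ ?_) <;>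
            exact h_coeff (by positivity) (by positivity) (by linarith)
      _ ≤ ‖u‖ * M + ‖v‖ * M := by
          rw [norm_mul, norm_mul]
          gcongr
          exacts [norm_recSol_le huv a b (n + 1), norm_recSol_le huv a b n]
      _ = (‖u‖ + ‖v‖) * M := by ring
      _ ≤ M := mul_le_of_le_one_left hM huv

lemma recSol_mem_graded {X : Type*} {𝒜 : ℕ → Submodule ℚ (X → ℂ)} [SetLike.GradedMonoid 𝒜]
    {g h : X → ℂ} (hg : g ∈ 𝒜 4) (hh : h ∈ 𝒜 6) {a b : ℂ} {s : ℕ}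
    (h₀ : (fun x => recSol (g x) (h x) a b s) ∈ 𝒜 0)
    (h₁ : (fun x => recSol (g x) (h x) a b (s + 1)) ∈ 𝒜 2)
    (h₂ : (fun x => recSol (g x) (h x) a b (s + 2)) ∈ 𝒜 4) :
    ∀ n : ℕ, (fun x => recSol (g x) (h x) a b (s + n)) ∈ 𝒜 (2 * n)
  | 0 => h₀
  | 1 => h₁
  | 2 => h₂
  | n + 3 => by
    have hg' := SetLike.mul_mem_graded hg (recSol_mem_graded hg hh h₀ h₁ h₂ (n + 1))
    have hh' := SetLike.mul_mem_graded hh (recSol_mem_graded hg hh h₀ h₁ h₂ n)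
    rw [show 4 + 2 * (n + 1) = 2 * (n + 3) by ring] at hg'
    rw [show 6 + 2 * n = 2 * (n + 3) by ring] at hh'
    convert add_mem ((𝒜 _).smul_mem ((2 * (s + n : ℕ) + 3) / (4 * (2 * (s + n : ℕ) + 5))) hg')
      ((𝒜 _).smul_mem (((s + n : ℕ) + 1) / (2 * (2 * (s + n : ℕ) + 5))) hh') using 1
    funext x
    simp only [Pi.add_apply, Pi.smul_apply, Pi.mul_apply, Rat.smul_def]
    rw [← add_assoc, recSol_add_three]
    push_cast
    rfl

end Recursion

/-! ## `Kₙ` and `Lₙ` as polynomials in `E₄` and `E₆` -/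

lemma aeval_mem_of_isWeightedHomogeneous {R S A σ M ι : Type*} [CommSemiring R] [CommSemiring S]
    [CommSemiring A] [Algebra R A] [Algebra S A] [SMul R S] [IsScalarTower R S A]
    [AddCommMonoid M] [AddCommMonoid ι] (φ : M →+ ι) {𝒜 : ι → Submodule S A}
    [SetLike.GradedMonoid 𝒜] {w : σ → M} {f : σ → A} (hf : ∀ i, f i ∈ 𝒜 (φ (w i))) {k : M}
    {P : MvPolynomial σ R} (hP : P.IsWeightedHomogeneous w k) : P.aeval f ∈ 𝒜 (φ k) := by
  induction hP using MvPolynomial.IsWeightedHomogeneous.induction_on with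
  | zero => simp
  | add p q _ _ hp hq => simpa only [map_add] using add_mem hp hq
  | monomial d r hd =>
    rw [MvPolynomial.aeval_monomial, ← Algebra.smul_def, ← hd, Finsupp.weight_apply,
      map_finsuppSum]
    simp only [map_nsmul]
    exact (𝒜 _).smul_of_tower_mem r
      (SetLike.prod_pow_mem_graded 𝒜 (fun i => φ (w i)) f d fun i _ => hf i)

/-- The functions on `ℍ` given by weighted homogeneous polynomials of weight `k` in `E₄` and `E₆`
with rational coefficients. -/
noncomputable def eisensteinPolynomial (k : ℕ) : Submodule ℚ (ℍ → ℂ) :=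
  (MvPolynomial.weightedHomogeneousSubmodule ℚ ![4, 6] k).map
    (MvPolynomial.aeval ![⇑ModularForm.E₄, ⇑ModularForm.E₆]).toLinearMap

instance : SetLike.GradedMonoid eisensteinPolynomial where
  one_mem := ⟨1, MvPolynomial.isWeightedHomogeneous_one _ _, map_one (MvPolynomial.aeval _)⟩
  mul_mem := by
    rintro _ _ _ _ ⟨P, hP, rfl⟩ ⟨Q, hQ, rfl⟩
    exact ⟨P * Q, hP.mul hQ, map_mul (MvPolynomial.aeval _) P Q⟩

lemma E₄_mem_eisensteinPolynomial : ⇑ModularForm.E₄ ∈ eisensteinPolynomial 4 :=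
  ⟨MvPolynomial.X 0, MvPolynomial.isWeightedHomogeneous_X _ _ _, by simp⟩

lemma E₆_mem_eisensteinPolynomial : ⇑ModularForm.E₆ ∈ eisensteinPolynomial 6 :=
  ⟨MvPolynomial.X 1, MvPolynomial.isWeightedHomogeneous_X _ _ _, by simp⟩

lemma g₂_mem_eisensteinPolynomial : g₂ ∈ eisensteinPolynomial 4 := by
  convert (eisensteinPolynomial 4).smul_mem (1 / 12) E₄_mem_eisensteinPolynomial using 1
  funext τ
  rw [g₂_eq, Pi.smul_apply, Rat.smul_def]
  push_cast
  ring

lemma g₃_mem_eisensteinPolynomial : g₃ ∈ eisensteinPolynomial 6 := by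
  convert (eisensteinPolynomial 6).smul_mem (-1 / 216) E₆_mem_eisensteinPolynomial using 1
  funext τ
  rw [g₃_eq, Pi.smul_apply, Rat.smul_def]
  push_cast
  ring

lemma K_mem_eisensteinPolynomial (n : ℕ) : K n ∈ eisensteinPolynomial (2 * n) := by
  have h₂ : (fun τ => recSol (g₂ τ) (g₃ τ) 1 0 2) ∈ eisensteinPolynomial 4 := by
    convert (eisensteinPolynomial 4).smul_mem (1 / 12) g₂_mem_eisensteinPolynomial using 1
    funext τ
    rw [recSol, Pi.smul_apply, Rat.smul_def]
    push_cast
    ring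
  convert recSol_mem_graded g₂_mem_eisensteinPolynomial g₃_mem_eisensteinPolynomial
    (a := 1) (b := 0) (s := 0) ?_ ?_ h₂ n using 1
  · funext τ
    rw [K, zero_add]
  · simpa only [recSol] using! SetLike.one_mem_graded eisensteinPolynomial
  · simpa only [recSol] using! zero_mem (eisensteinPolynomial 2)

lemma L_mem_eisensteinPolynomial (n : ℕ) : L n ∈ eisensteinPolynomial (2 * n) := by
  have h₂ : (fun τ => recSol (g₂ τ) (g₃ τ) 0 1 3) ∈ eisensteinPolynomial 4 := by
    convert (eisensteinPolynomial 4).smul_mem (3 / 20) g₂_mem_eisensteinPolynomial using 1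
    funext τ
    simp only [recSol, Pi.smul_apply, Rat.smul_def]
    push_cast
    ring
  convert recSol_mem_graded g₂_mem_eisensteinPolynomial g₃_mem_eisensteinPolynomial
    (a := 0) (b := 1) (s := 1) ?_ ?_ h₂ n using 1
  · funext τ
    rw [L, add_comm]
  · simpa only [recSol] using! SetLike.one_mem_graded eisensteinPolynomial
  · simpa only [recSol, mul_zero, zero_div] using! zero_mem (eisensteinPolynomial 2)

lemma exists_aeval_eq_of_mem_eisensteinPolynomial {k : ℕ} {F : ℍ → ℂ}
    (hF : F ∈ eisensteinPolynomial k) :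
    ∃ P : MvPolynomial (Fin 2) ℚ, P.IsWeightedHomogeneous ![4, 6] k ∧
      ∀ τ : ℍ, F τ = P.aeval ![ModularForm.E₄ τ, ModularForm.E₆ τ] := by
  obtain ⟨P, hP, rfl⟩ := hF
  refine ⟨P, hP, fun τ => ?_⟩
  change Pi.evalAlgHom ℚ (fun _ : ℍ => ℂ) τ (P.aeval ![⇑ModularForm.E₄, ⇑ModularForm.E₆]) = _
  rw [MvPolynomial.comp_aeval_apply]
  congr 2
  funext i
  fin_cases i <;> rfl

/-! ## Modularity -/

/-- The modular forms of weight `k` for `Γ`, as a space of functions on `ℍ`; products of forms of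
different weights can then be compared inside the single algebra `ℍ → ℂ`. -/
noncomputable def modularFormSubmodule (Γ : Subgroup (GL (Fin 2) ℝ)) [Γ.HasDetOne] (k : ℤ) :
    Submodule ℂ (ℍ → ℂ) where
  carrier := Set.range fun f : ModularForm Γ k => ⇑f
  add_mem' := by
    rintro _ _ ⟨f, rfl⟩ ⟨g, rfl⟩
    exact ⟨f + g, funext fun τ => add_apply f g τ⟩
  zero_mem' := ⟨0, funext fun τ => zero_apply τ⟩
  smul_mem' := by
    rintro c _ ⟨f, rfl⟩
    exact ⟨c • f, rfl⟩

instance (Γ : Subgroup (GL (Fin 2) ℝ)) [Γ.HasDetOne] :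
    SetLike.GradedMonoid (modularFormSubmodule Γ) where
  one_mem := ⟨1, ModularForm.one_coe_eq_one⟩
  mul_mem := by
    rintro _ _ _ _ ⟨f, rfl⟩ ⟨g, rfl⟩
    exact ⟨f.mul g, ModularForm.coe_mul f g⟩

lemma mem_modularFormSubmodule_of_mem_eisensteinPolynomial {k : ℕ} {F : ℍ → ℂ}
    (hF : F ∈ eisensteinPolynomial k) : F ∈ modularFormSubmodule 𝒮ℒ k := by
  obtain ⟨P, hP, rfl⟩ := hF
  refine aeval_mem_of_isWeightedHomogeneous (Nat.castAddMonoidHom ℤ) (fun i => ?_) hP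
  fin_cases i
  exacts [⟨ModularForm.E₄, rfl⟩, ⟨ModularForm.E₆, rfl⟩]

lemma exists_modularForm_eq_of_mem_eisensteinPolynomial {n : ℕ} {F : ℍ → ℂ}
    (hF : F ∈ eisensteinPolynomial (2 * n)) : ∃ f : ModularForm 𝒮ℒ (2 * n), ∀ τ : ℍ, f τ = F τ := by
  have hF' : F ∈ modularFormSubmodule 𝒮ℒ (2 * n) := by
    exact_mod_cast mem_modularFormSubmodule_of_mem_eisensteinPolynomial hF
  exact hF'.imp fun _ => congrFun

end SU3

namespace SU3

open Filter Topology

/-! ## The Weierstrass function and its derivative -/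

section Weierstrass

lemma countable_of_forall_eventually_notMem {X : Type*} [TopologicalSpace X]
    [SecondCountableTopology X] {S : Set X} (hS : ∀ x ∈ S, ∀ᶠ y in 𝓝[≠] x, y ∉ S) :
    S.Countable := by
  have : DiscreteTopology S := by
    rw [discreteTopology_subtype_iff]
    intro x hx
    rw [← Filter.empty_mem_iff_bot, Filter.mem_inf_principal]
    exact hS x hx
  exact Set.countable_coe_iff.mp (TopologicalSpace.separableSpace_iff_countable.mp inferInstance)

variable (Λ : PeriodPair)

lemma countable_lattice : (Λ.lattice : Set ℂ).Countable :=
  Set.countable_coe_iff.mp Λ.latticeEquivProd.injective.countable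

lemma isOpen_compl_lattice : IsOpen (Λ.lattice : Set ℂ)ᶜ :=
  Λ.isClosed_lattice.isOpen_compl

lemma isPreconnected_compl_lattice : IsPreconnected (Λ.lattice : Set ℂ)ᶜ :=
  (Set.Countable.isConnected_compl_of_one_lt_rank (by simp [Complex.rank_real_complex])
    (countable_lattice Λ)).isPreconnected

lemma exists_derivWeierstrassP_ne_zero : ∃ z ∉ Λ.lattice, Λ.derivWeierstrassP z ≠ 0 := by
  by_contra! h_zero
  -- `z³ ℘'(z)` tends to `-2` at the triple pole `0`.
  have h_lim : Tendsto (fun z : ℂ => z ^ 3 * Λ.derivWeierstrassPExcept 0 z) (𝓝[≠] 0) (𝓝 0) := by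
    have h_cont : ContinuousAt (fun z : ℂ => z ^ 3 * Λ.derivWeierstrassPExcept 0 z) 0 :=
      (continuousAt_id.pow 3).mul (Λ.analyticAt_derivWeierstrassPExcept 0).continuousAt
    simpa using h_cont.tendsto.mono_left nhdsWithin_le_nhds
  have h_eq : (fun _ : ℂ => (2 : ℂ)) =ᶠ[𝓝[≠] 0]
      fun z : ℂ => z ^ 3 * Λ.derivWeierstrassPExcept 0 z := by
    filter_upwards [self_mem_nhdsWithin, mem_nhdsWithin_of_mem_nhds
      (Λ.compl_lattice_sdiff_singleton_mem_nhds 0)] with z hz₀ hz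
    have hz₀ : z ≠ 0 := hz₀
    have hzΛ : z ∉ Λ.lattice := fun hm => hz ⟨hm, hz₀⟩
    have h_def := Λ.derivWeierstrassPExcept_def 0 z
    rw [ZeroMemClass.coe_zero, h_zero z hzΛ, sub_zero] at h_def
    rw [h_def]
    field_simp
    ring
  exact two_ne_zero (tendsto_nhds_unique (tendsto_const_nhds.congr' h_eq) h_lim)

variable {Λ} in
lemma eventually_derivWeierstrassP_ne_zero {z : ℂ} (hz : z ∉ Λ.lattice) :
    ∀ᶠ w in 𝓝[≠] z, Λ.derivWeierstrassP w ≠ 0 := by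
  by_contra h
  have h_freq : ∃ᶠ w in 𝓝[≠] z, Λ.derivWeierstrassP w = 0 := by
    simpa [Filter.not_eventually] using h
  obtain ⟨y, hy, hy₀⟩ := exists_derivWeierstrassP_ne_zero Λ
  exact hy₀ (Λ.analyticOnNhd_derivWeierstrassP.eqOn_zero_of_preconnected_of_frequently_eq_zero
    (isPreconnected_compl_lattice Λ) hz h_freq hy)

lemma countable_setOf_derivWeierstrassP_eq_zero : {z | Λ.derivWeierstrassP z = 0}.Countable := by
  have h_off : ({z | Λ.derivWeierstrassP z = 0} \ Λ.lattice).Countable := by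
    refine countable_of_forall_eventually_notMem fun z hz => ?_
    filter_upwards [eventually_derivWeierstrassP_ne_zero hz.2] with w hw hw'
    exact hw hw'.1
  refine (h_off.union (countable_lattice Λ)).mono ?_
  rw [Set.sdiff_union_self]
  exact Set.subset_union_left

variable {Λ}

lemma hasDerivAt_weierstrassP {z : ℂ} (hz : z ∉ Λ.lattice) :
    HasDerivAt Λ.weierstrassP (Λ.derivWeierstrassP z) z := by
  rw [← Λ.deriv_weierstrassP]
  exact (Λ.analyticOnNhd_weierstrassP z hz).differentiableAt.hasDerivAt

lemma deriv_derivWeierstrassP_of_ne_zero {z : ℂ} (hz : z ∉ Λ.lattice)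
    (hz₀ : Λ.derivWeierstrassP z ≠ 0) :
    deriv Λ.derivWeierstrassP z = 6 * Λ.weierstrassP z ^ 2 - Λ.g₂ / 2 := by
  have h_sq := (Λ.analyticOnNhd_derivWeierstrassP z hz).differentiableAt.hasDerivAt.pow 2
  have h_cubic := ((((hasDerivAt_weierstrassP hz).pow 3).const_mul 4).sub
    ((hasDerivAt_weierstrassP hz).const_mul Λ.g₂)).sub_const Λ.g₃
  have h_eq := (h_sq.congr_of_eventuallyEq (by
    filter_upwards [(isOpen_compl_lattice Λ).mem_nhds hz] with y hy
    exact (Λ.derivWeierstrassP_sq y hy).symm)).unique h_cubic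
  apply mul_left_cancel₀ hz₀
  norm_num at h_eq
  linear_combination h_eq / 2

lemma deriv_derivWeierstrassP {z : ℂ} (hz : z ∉ Λ.lattice) :
    deriv Λ.derivWeierstrassP z = 6 * Λ.weierstrassP z ^ 2 - Λ.g₂ / 2 := by
  have h_deriv : ContinuousAt (deriv Λ.derivWeierstrassP) z :=
    (Λ.analyticOnNhd_derivWeierstrassP z hz).deriv.continuousAt
  have h_poly : ContinuousAt (fun w => 6 * Λ.weierstrassP w ^ 2 - Λ.g₂ / 2) z :=
    (((Λ.analyticOnNhd_weierstrassP z hz).continuousAt.pow 2).const_mul 6).sub_const _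
  refine tendsto_nhds_unique (h_deriv.tendsto.mono_left (nhdsWithin_le_nhds (s := {z}ᶜ)))
    ((h_poly.tendsto.mono_left (nhdsWithin_le_nhds (s := {z}ᶜ))).congr' ?_)
  filter_upwards [eventually_derivWeierstrassP_ne_zero hz,
    mem_nhdsWithin_of_mem_nhds ((isOpen_compl_lattice Λ).mem_nhds hz)] with w hw hwΛ
  exact (deriv_derivWeierstrassP_of_ne_zero hwΛ hw).symm

end Weierstrass

variable {τ : ℍ} {z : ℂ}

lemma hasDerivAt_wp (hz : z ∉ (periods τ).lattice) : HasDerivAt (wp τ) (wp' τ z) z :=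
  hasDerivAt_weierstrassP hz

lemma hasDerivAt_wp' (hz : z ∉ (periods τ).lattice) :
    HasDerivAt (wp' τ) (6 * wp τ z ^ 2 - g₂ τ / 2) z := by
  have h := ((periods τ).analyticOnNhd_derivWeierstrassP z hz).differentiableAt.hasDerivAt
  rw [deriv_derivWeierstrassP hz] at h
  exact h

lemma wp'_sq (hz : z ∉ (periods τ).lattice) :
    wp' τ z ^ 2 = 4 * wp τ z ^ 3 - g₂ τ * wp τ z - g₃ τ :=
  (periods τ).derivWeierstrassP_sq z hz

/-! ## Integrals along cycles -/

namespace IsCycle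

variable {c : ℂ} {γ : ℝ → ℂ}

lemma hasDerivAt (hγ : IsCycle τ c γ) (t : ℝ) : HasDerivAt γ (deriv γ t) t :=
  (hγ.contDiff.differentiable one_ne_zero t).hasDerivAt

lemma continuous_deriv (hγ : IsCycle τ c γ) : Continuous (deriv γ) :=
  hγ.contDiff.continuous_deriv le_rfl

lemma notMem_lattice (hγ : IsCycle τ c γ) {t : ℝ} (ht : t ∈ Set.uIcc (0 : ℝ) 1) :
    γ t ∉ (periods τ).lattice :=
  hγ.avoids t (by rwa [Set.uIcc_of_le zero_le_one] at ht)

lemma continuousOn_comp (hγ : IsCycle τ c γ) {f : ℂ → ℂ}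
    (hf : ∀ z ∉ (periods τ).lattice, ContinuousAt f z) :
    ContinuousOn (fun t => f (γ t)) (Set.uIcc 0 1) := fun _ ht =>
  ((hf _ (hγ.notMem_lattice ht)).comp (f := γ)
    hγ.contDiff.continuous.continuousAt).continuousWithinAt

lemma continuousOn_wp (hγ : IsCycle τ c γ) : ContinuousOn (fun t => wp τ (γ t)) (Set.uIcc 0 1) :=
  hγ.continuousOn_comp fun _ hz => (hasDerivAt_wp hz).continuousAt

lemma continuousOn_wp' (hγ : IsCycle τ c γ) :
    ContinuousOn (fun t => wp' τ (γ t)) (Set.uIcc 0 1) :=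
  hγ.continuousOn_comp fun _ hz => (hasDerivAt_wp' hz).continuousAt

lemma integral_eq_sub (hγ : IsCycle τ c γ) {F f : ℂ → ℂ}
    (hF : ∀ z ∉ (periods τ).lattice, HasDerivAt F (f z) z)
    (hf : ∀ z ∉ (periods τ).lattice, ContinuousAt f z) :
    ∫ t in (0 : ℝ)..1, f (γ t) * deriv γ t = F (γ 0 + c) - F (γ 0) := by
  rw [← hγ.end_eq]
  exact intervalIntegral.integral_eq_sub_of_hasDerivAt (f := fun t => F (γ t))
    (fun t ht => (hF _ (hγ.notMem_lattice ht)).comp t (hγ.hasDerivAt t))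
    ((hγ.continuousOn_comp hf).mul hγ.continuous_deriv.continuousOn).intervalIntegrable

lemma intervalIntegrable_wp_pow (hγ : IsCycle τ c γ) (n : ℕ) :
    IntervalIntegrable (fun t => wp τ (γ t) ^ n * deriv γ t) MeasureTheory.volume 0 1 :=
  ((hγ.continuousOn_wp.pow n).mul hγ.continuous_deriv.continuousOn).intervalIntegrable

lemma cycleIntegral_zero (hγ : IsCycle τ c γ) :
    cycleIntegral τ γ 0 = (2 * Real.pi * Complex.I)⁻¹ * c := by
  have h := hγ.integral_eq_sub (F := id) (f := fun _ => 1) (fun z _ => hasDerivAt_id z)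
    fun z _ => continuousAt_const
  simp only [cycleIntegral, pow_zero]
  rw [h]
  simp

lemma integral_deriv_wp_pow_mul_wp' (hγ : IsCycle τ c γ) (hc : c ∈ (periods τ).lattice) (n : ℕ) :
    ∫ t in (0 : ℝ)..1, (n * wp τ (γ t) ^ (n - 1) * wp' τ (γ t) * wp' τ (γ t) +
      wp τ (γ t) ^ n * (6 * wp τ (γ t) ^ 2 - g₂ τ / 2)) * deriv γ t = 0 := by
  rw [hγ.integral_eq_sub (F := fun z => wp τ z ^ n * wp' τ z)
    (f := fun z => n * wp τ z ^ (n - 1) * wp' τ z * wp' τ z +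
      wp τ z ^ n * (6 * wp τ z ^ 2 - g₂ τ / 2))]
  · have h_wp : wp τ (γ 0 + c) = wp τ (γ 0) := (periods τ).weierstrassP_add_coe (γ 0) ⟨c, hc⟩
    have h_wp' : wp' τ (γ 0 + c) = wp' τ (γ 0) :=
      (periods τ).derivWeierstrassP_add_coe (γ 0) ⟨c, hc⟩
    rw [h_wp, h_wp', sub_self]
  · exact fun z hz => ((hasDerivAt_wp hz).pow n).mul (hasDerivAt_wp' hz)
  · intro z hz
    have h_wp := (hasDerivAt_wp hz).continuousAt
    have h_wp' := (hasDerivAt_wp' hz).continuousAt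
    fun_prop

lemma cycleIntegral_two (hγ : IsCycle τ c γ) (hc : c ∈ (periods τ).lattice) :
    12 * cycleIntegral τ γ 2 = g₂ τ * cycleIntegral τ γ 0 := by
  have h := hγ.integral_deriv_wp_pow_mul_wp' hc 0
  have h_eq : ∀ t, (((0 : ℕ) : ℂ) * wp τ (γ t) ^ (0 - 1) * wp' τ (γ t) * wp' τ (γ t) +
      wp τ (γ t) ^ 0 * (6 * wp τ (γ t) ^ 2 - g₂ τ / 2)) * deriv γ t =
      6 * (wp τ (γ t) ^ 2 * deriv γ t) - g₂ τ / 2 * (wp τ (γ t) ^ 0 * deriv γ t) := fun t => by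
    push_cast
    ring
  simp only [h_eq] at h
  rw [intervalIntegral.integral_sub ((hγ.intervalIntegrable_wp_pow 2).const_mul _)
      ((hγ.intervalIntegrable_wp_pow 0).const_mul _),
    intervalIntegral.integral_const_mul, intervalIntegral.integral_const_mul] at h
  simp only [cycleIntegral]
  linear_combination 2 * (2 * Real.pi * Complex.I)⁻¹ * h

lemma cycleIntegral_add_three (hγ : IsCycle τ c γ) (hc : c ∈ (periods τ).lattice) (n : ℕ) :
    (8 * n + 20) * cycleIntegral τ γ (n + 3) =
      (2 * n + 3) * g₂ τ * cycleIntegral τ γ (n + 1) +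
        (2 * n + 2) * g₃ τ * cycleIntegral τ γ n := by
  have h_int := hγ.intervalIntegrable_wp_pow
  have h := hγ.integral_deriv_wp_pow_mul_wp' hc (n + 1)
  have h_eq : Set.EqOn
      (fun t => (((n + 1 : ℕ) : ℂ) * wp τ (γ t) ^ (n + 1 - 1) * wp' τ (γ t) * wp' τ (γ t) +
        wp τ (γ t) ^ (n + 1) * (6 * wp τ (γ t) ^ 2 - g₂ τ / 2)) * deriv γ t)
      (fun t => (4 * n + 10) * (wp τ (γ t) ^ (n + 3) * deriv γ t) -
        (n + 3 / 2) * g₂ τ * (wp τ (γ t) ^ (n + 1) * deriv γ t) -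
        (n + 1) * g₃ τ * (wp τ (γ t) ^ n * deriv γ t)) (Set.uIcc 0 1) := by
    intro t ht
    simp only [Nat.add_sub_cancel]
    push_cast
    linear_combination (n + 1) * wp τ (γ t) ^ n * deriv γ t * wp'_sq (hγ.notMem_lattice ht)
  rw [intervalIntegral.integral_congr h_eq,
    intervalIntegral.integral_sub (((h_int _).const_mul _).sub ((h_int _).const_mul _))
      ((h_int n).const_mul _),
    intervalIntegral.integral_sub ((h_int _).const_mul _) ((h_int _).const_mul _)] at h
  simp only [intervalIntegral.integral_const_mul] at h
  simp only [cycleIntegral]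
  linear_combination 2 * (2 * Real.pi * Complex.I)⁻¹ * h

lemma recursion_cycleIntegral (hγ : IsCycle τ c γ) (hc : c ∈ (periods τ).lattice) :
    Recursion (g₂ τ) (g₃ τ) (cycleIntegral τ γ) := by
  refine ⟨hγ.cycleIntegral_two hc, fun m hm => ?_⟩
  obtain ⟨n, rfl⟩ := Nat.exists_eq_add_of_le' hm
  rw [Nat.add_sub_cancel, show n + 3 - 2 = n + 1 by omega]
  push_cast
  linear_combination hγ.cycleIntegral_add_three hc n

end IsCycle

lemma two_pi_I_mem_lattice (τ : ℍ) : 2 * Real.pi * Complex.I ∈ (periods τ).lattice :=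
  (periods τ).ω₁_mem_lattice

lemma two_pi_I_mul_mem_lattice (τ : ℍ) : 2 * Real.pi * Complex.I * τ ∈ (periods τ).lattice :=
  (periods τ).ω₂_mem_lattice

lemma IsACycle.recursion {γ : ℝ → ℂ} (hγ : IsACycle τ γ) :
    Recursion (g₂ τ) (g₃ τ) (cycleIntegral τ γ) :=
  IsCycle.recursion_cycleIntegral hγ (two_pi_I_mem_lattice τ)

lemma IsBCycle.recursion {γ : ℝ → ℂ} (hγ : IsBCycle τ γ) :
    Recursion (g₂ τ) (g₃ τ) (cycleIntegral τ γ) :=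
  IsCycle.recursion_cycleIntegral hγ (two_pi_I_mul_mem_lattice τ)

/-! ## Existence of cycles off the branch points -/

lemma exists_forall_add_mul_notMem {S : Set ℂ} (hS : S.Countable) {c : ℂ} (hc : c ≠ 0) :
    ∃ z₀ : ℂ, ∀ t : ℝ, z₀ + t * c ∉ S := by
  -- `(· / c).im` is constant on each line of direction `c` and takes countably many values on `S`.
  obtain ⟨r, hr⟩ : ((fun s : ℂ => (s / c).im) '' S)ᶜ.Nonempty := by
    rw [Set.nonempty_compl]
    intro h
    exact Set.not_countable_univ (h ▸ hS.image _)
  refine ⟨r * Complex.I * c, fun t ht => hr ⟨_, ht, ?_⟩⟩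
  have h_div : (r * Complex.I * c + t * c) / c = t + r * Complex.I := by field_simp; ring
  simp [h_div]

lemma exists_isCycle (τ : ℍ) {c : ℂ} (hc : c ≠ 0) :
    ∃ γ : ℝ → ℂ, IsCycle τ c γ ∧ ∀ t, wp' τ (γ t) ≠ 0 := by
  obtain ⟨z₀, hz₀⟩ := exists_forall_add_mul_notMem
    (countable_setOf_derivWeierstrassP_eq_zero (periods τ)) hc
  refine ⟨fun t => z₀ + t * c, ⟨?_, by simp, fun t _ ht => hz₀ t ?_⟩, hz₀⟩
  · exact contDiff_const.add (Complex.ofRealCLM.contDiff.mul contDiff_const)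
  -- On the lattice the function `derivWeierstrassP` has the junk value `0`.
  · exact (periods τ).derivWeierstrassP_coe ⟨_, ht⟩

lemma exists_isACycle_isBCycle (τ : ℍ) :
    ∃ γA γB : ℝ → ℂ, IsACycle τ γA ∧ IsBCycle τ γB ∧
      ∀ t ∈ Set.Icc (0 : ℝ) 1, wp' τ (γA t) ≠ 0 ∧ wp' τ (γB t) ≠ 0 := by
  obtain ⟨γA, hA, hA₀⟩ := exists_isCycle τ Complex.two_pi_I_ne_zero
  obtain ⟨γB, hB, hB₀⟩ := exists_isCycle τ
    (mul_ne_zero Complex.two_pi_I_ne_zero (UpperHalfPlane.ne_zero τ))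
  exact ⟨γA, γB, hA, hB, fun t _ => ⟨hA₀ t, hB₀ t⟩⟩

end SU3

namespace SU3

/-! ## The integral of `℘` -/

open Filter Topology SummationFilter

lemma hasSum_intervalIntegral_mul {ι : Type*} [Countable ι] {F : ι → ℝ → ℂ} {f g : ℝ → ℂ} {a b : ℝ}
    (hF : HasSumLocallyUniformlyOn F f (Set.uIcc a b))
    (hF_cont : ∀ i, ContinuousOn (F i) (Set.uIcc a b)) (hg : ContinuousOn g (Set.uIcc a b)) :
    HasSum (fun i => ∫ t in a..b, F i t * g t) (∫ t in a..b, f t * g t) := by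
  have h_partial : ∀ s : Finset ι, ContinuousOn (fun t => ∑ i ∈ s, F i t) (Set.uIcc a b) :=
    fun s => continuousOn_finsetSum s fun i _ => hF_cont i
  have h_const : TendstoLocallyUniformlyOn (fun _ : Finset ι => g) g atTop (Set.uIcc a b) :=
    fun u hu t _ => ⟨Set.univ, univ_mem, .of_forall fun _ _ _ => refl_mem_uniformity hu⟩
  have h_mul : TendstoLocallyUniformlyOn (fun (s : Finset ι) t => (∑ i ∈ s, F i t) * g t)
      (fun t => f t * g t) atTop (Set.uIcc a b) :=
    hF.fun_mul₀ h_const (hF.continuousOn (Frequently.of_forall h_partial)) hg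
  have h_unif :=
    (tendstoLocallyUniformlyOn_iff_tendstoUniformlyOn_of_compact isCompact_uIcc).mp h_mul
  refine (h_unif.tendsto_intervalIntegral_of_continuousOn (μ := MeasureTheory.volume)
    (Eventually.of_forall fun s => (h_partial s).fun_mul hg)).congr fun s => ?_
  simp only [Finset.sum_mul]
  exact intervalIntegral.integral_finsetSum fun i _ =>
    ((hF_cont i).fun_mul hg).intervalIntegrable

lemma IsCycle.hasSum_integral_wp {τ : ℍ} {c : ℂ} {γ : ℝ → ℂ} (hγ : IsCycle τ c γ) :
    HasSum (fun l : (periods τ).lattice =>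
      (γ 0 - l)⁻¹ - (γ 0 + c - l)⁻¹ - c * ((l : ℂ) ^ 2)⁻¹)
      (∫ t in (0 : ℝ)..1, wp τ (γ t) * deriv γ t) := by
  have h_ne : ∀ l : (periods τ).lattice, ∀ z ∉ (periods τ).lattice, z - (l : ℂ) ≠ 0 :=
    fun l z hz h => hz (sub_eq_zero.mp h ▸ l.2)
  have h_cont : ∀ l : (periods τ).lattice, ∀ z ∉ (periods τ).lattice,
      ContinuousAt (fun z => 1 / (z - l) ^ 2 - 1 / (l : ℂ) ^ 2) z := fun l z hz => by
    have := pow_ne_zero 2 (h_ne l z hz)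
    fun_prop (disch := assumption)
  have h_sum := (periods τ).hasSumLocallyUniformly_weierstrassP.hasSumLocallyUniformlyOn.comp γ
    (Set.mapsTo_univ γ (Set.uIcc 0 1)) hγ.contDiff.continuous.continuousOn
  refine (hasSum_intervalIntegral_mul h_sum (fun l => hγ.continuousOn_comp (h_cont l))
    hγ.continuous_deriv.continuousOn).congr_fun fun l => ?_
  have h_primitive : ∀ z ∉ (periods τ).lattice,
      HasDerivAt (fun z => -(z - (l : ℂ))⁻¹ - z * (1 / (l : ℂ) ^ 2))
        (1 / (z - l) ^ 2 - 1 / (l : ℂ) ^ 2) z := fun z hz => by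
    have h_inv := (((hasDerivAt_id z).sub_const (l : ℂ)).inv (h_ne l z hz)).neg
    refine (h_inv.sub ((hasDerivAt_id z).mul_const (1 / (l : ℂ) ^ 2))).congr_deriv ?_
    simp [neg_div]
  rw [hγ.integral_eq_sub h_primitive (h_cont l), one_div]
  ring

lemma tsum_int_inv_sub_add_one_sub_inv_sub {a : ℂ}
    (h : Summable fun n : ℤ => (a - (n + 1))⁻¹ - (a - n)⁻¹) :
    ∑' n : ℤ, ((a - (n + 1))⁻¹ - (a - n)⁻¹) = 0 := by
  rw [← tsum_eq_of_summable_unconditional (L := symmetricIco ℤ) h]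
  refine HasSum.tsum_eq (hasSum_symmetricIco_int_iff.mpr ?_)
  have h_lim : Tendsto (fun N : ℕ => (a - N)⁻¹ - (a + N)⁻¹) atTop (𝓝 0) := by
    simpa using (EisensteinSeries.tendsto_zero_inv_linear_sub a 1).sub
      (EisensteinSeries.tendsto_zero_inv_linear a 1)
  refine h_lim.congr fun N => ?_
  have h_telescope := Finset.sum_Ico_int_sub N (fun n : ℤ => -(a - n)⁻¹)
  push_cast at h_telescope
  simp only [sub_neg_eq_add, neg_add_eq_sub] at h_telescope
  rw [h_telescope]

lemma tsum_int_inv_sub_sub_inv_add_one_sub_sub_inv_sq (σ : ℍ) (m : ℤ) (z : ℂ)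
    (h : Summable fun n : ℤ =>
      (z - (m * σ + n))⁻¹ - (z + 1 - (m * σ + n))⁻¹ - ((m * (σ : ℂ) + n) ^ 2)⁻¹) :
    ∑' n : ℤ, ((z - (m * σ + n))⁻¹ - (z + 1 - (m * σ + n))⁻¹ - ((m * (σ : ℂ) + n) ^ 2)⁻¹) =
      -EisensteinSeries.e2Summand m σ := by
  have h_eis : ∀ n : ℤ, EisensteinSeries.eisSummand 2 ![m, n] σ = ((m * (σ : ℂ) + n) ^ 2)⁻¹ :=
    fun n => by simp [EisensteinSeries.eisSummand, zpow_ofNat]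
  have h_sq := EisensteinSeries.e2Summand_summable m σ
  simp only [h_eis] at h_sq
  have h_shift : ∀ n : ℤ, (z - (m * σ + n))⁻¹ - (z + 1 - (m * σ + n))⁻¹ =
      (z + 1 - m * σ - (n + 1))⁻¹ - (z + 1 - m * σ - n)⁻¹ := fun n => by
    congr 2 <;> ring
  simp only [h_shift] at h ⊢
  have h_diff : Summable fun n : ℤ => (z + 1 - m * σ - (n + 1))⁻¹ - (z + 1 - m * σ - n)⁻¹ := by
    simpa using h.add h_sq
  rw [h_diff.tsum_sub h_sq, tsum_int_inv_sub_add_one_sub_inv_sub h_diff, zero_sub,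
    EisensteinSeries.e2Summand]
  simp only [h_eis]

lemma eq_neg_G2_of_hasSum {σ : ℍ} {z s : ℂ}
    (h : HasSum (fun p : ℤ × ℤ =>
      (z - (p.1 * σ + p.2))⁻¹ - (z + 1 - (p.1 * σ + p.2))⁻¹ - ((p.1 * (σ : ℂ) + p.2) ^ 2)⁻¹) s) :
    s = -EisensteinSeries.G2 σ := by
  have h_rows := h.prod_fiberwise fun m => (h.summable.prod_factor m).hasSum
  have h_row : ∀ m : ℤ, _ = _ := fun m =>
    tsum_int_inv_sub_sub_inv_add_one_sub_sub_inv_sq σ m z (h.summable.prod_factor m)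
  simp only [h_row] at h_rows
  rw [← h_rows.tsum_eq, tsum_neg, EisensteinSeries.G2,
    tsum_eq_of_summable_unconditional (L := symmetricIcc ℤ) (by simpa using h_rows.summable.neg)]

/-- The two sides of Legendre's relation come from summing the lattice sum along rows parallel to
the cycle, so `(b, σ)` is the basis of the lattice that starts with the cycle. -/
lemma IsCycle.integral_wp {τ σ : ℍ} {b : ℂ} {γ : ℝ → ℂ} (hγ : IsCycle τ b γ) (hb : b ≠ 0)
    (e : ℤ × ℤ ≃ (periods τ).lattice) (he : ∀ p, (e p : ℂ) = b * (p.1 * σ + p.2)) :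
    ∫ t in (0 : ℝ)..1, wp τ (γ t) * deriv γ t = -b⁻¹ * EisensteinSeries.G2 σ := by
  have h := (e.hasSum_iff.mpr hγ.hasSum_integral_wp).mul_left b
  have h_scale : ∀ p : ℤ × ℤ,
      b * ((γ 0 - e p)⁻¹ - (γ 0 + b - e p)⁻¹ - b * ((e p : ℂ) ^ 2)⁻¹) =
        (γ 0 / b - (p.1 * σ + p.2))⁻¹ - (γ 0 / b + 1 - (p.1 * σ + p.2))⁻¹ -
          ((p.1 * (σ : ℂ) + p.2) ^ 2)⁻¹ := fun p => by
    have h₁ : γ 0 - e p = b * (γ 0 / b - (p.1 * σ + p.2)) := by rw [he]; field_simp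
    have h₂ : γ 0 + b - e p = b * (γ 0 / b + 1 - (p.1 * σ + p.2)) := by rw [he]; field_simp
    rw [h₁, h₂, he, mul_inv, mul_inv, mul_pow, mul_inv]
    field_simp
  simp only [Function.comp_apply, h_scale] at h
  rw [neg_mul, ← mul_neg, ← eq_neg_G2_of_hasSum h, inv_mul_cancel_left₀ hb]

variable {τ : ℍ} {γ γA γB : ℝ → ℂ}

lemma IsACycle.integral_wp (hγ : IsACycle τ γ) :
    ∫ t in (0 : ℝ)..1, wp τ (γ t) * deriv γ t =
      -(2 * Real.pi * Complex.I)⁻¹ * EisensteinSeries.G2 τ :=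
  IsCycle.integral_wp hγ Complex.two_pi_I_ne_zero
    ((Equiv.prodComm ℤ ℤ).trans (periods τ).latticeEquivProd.symm.toEquiv)
    fun p => latticeEquivProd_symm_periods τ p.swap

lemma IsBCycle.integral_wp (hγ : IsBCycle τ γ) :
    ∫ t in (0 : ℝ)..1, wp τ (γ t) * deriv γ t =
      -(2 * Real.pi * Complex.I * τ)⁻¹ * EisensteinSeries.G2 (ModularGroup.S • τ) := by
  have hτ : (τ : ℂ) ≠ 0 := UpperHalfPlane.ne_zero τ
  refine IsCycle.integral_wp hγ (mul_ne_zero Complex.two_pi_I_ne_zero hτ)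
    (((Equiv.neg ℤ).prodCongr (Equiv.refl ℤ)).trans (periods τ).latticeEquivProd.symm.toEquiv)
    fun p => (latticeEquivProd_symm_periods τ (-p.1, p.2)).trans ?_
  rw [UpperHalfPlane.modular_S_smul]
  field_simp
  push_cast
  ring

lemma G2_eq_E2 (τ : ℍ) : EisensteinSeries.G2 τ = Real.pi ^ 2 / 3 * EisensteinSeries.E2 τ := by
  have hπ : (Real.pi : ℂ) ≠ 0 := by exact_mod_cast Real.pi_ne_zero
  rw [EisensteinSeries.E2, Pi.smul_apply, smul_eq_mul, riemannZeta_two]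
  field_simp
  ring

lemma IsACycle.cycleIntegral_zero (hγ : IsACycle τ γ) : cycleIntegral τ γ 0 = 1 := by
  rw [IsCycle.cycleIntegral_zero hγ, inv_mul_cancel₀ Complex.two_pi_I_ne_zero]

lemma IsBCycle.cycleIntegral_zero (hγ : IsBCycle τ γ) : cycleIntegral τ γ 0 = τ := by
  rw [IsCycle.cycleIntegral_zero hγ, inv_mul_cancel_left₀ Complex.two_pi_I_ne_zero]

lemma IsACycle.cycleIntegral_one (hγ : IsACycle τ γ) :
    cycleIntegral τ γ 1 = EisensteinSeries.E2 τ / 12 := by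
  have hπ : (Real.pi : ℂ) ≠ 0 := by exact_mod_cast Real.pi_ne_zero
  simp only [cycleIntegral, pow_one]
  rw [hγ.integral_wp, G2_eq_E2]
  field_simp
  rw [Complex.I_sq]
  ring

lemma IsBCycle.cycleIntegral_one (hγ : IsBCycle τ γ) :
    cycleIntegral τ γ 1 =
      τ * (EisensteinSeries.E2 τ / 12) + 1 / (2 * Real.pi * Complex.I) := by
  have hπ : (Real.pi : ℂ) ≠ 0 := by exact_mod_cast Real.pi_ne_zero
  have hτ : (τ : ℂ) ≠ 0 := UpperHalfPlane.ne_zero τ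
  have h_S : EisensteinSeries.G2 (ModularGroup.S • τ) =
      (τ : ℂ) ^ 2 * EisensteinSeries.G2 τ - 2 * Real.pi * Complex.I * τ := by
    rw [EisensteinSeries.G2_S_transform τ]
    field_simp
    ring
  simp only [cycleIntegral, pow_one]
  rw [hγ.integral_wp, h_S, G2_eq_E2]
  field_simp
  linear_combination (-12 * Real.pi * τ * EisensteinSeries.E2 τ) * Complex.I_sq

lemma IsACycle.cycleIntegral_succ (hγ : IsACycle τ γ) (n : ℕ) :
    cycleIntegral τ γ (n + 1) = K (n + 1) τ + EisensteinSeries.E2 τ / 12 * L n τ := by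
  rw [hγ.recursion.eq_recSol, recSol_eq_combination, hγ.cycleIntegral_zero, hγ.cycleIntegral_one,
    one_mul, K, L]

lemma IsBCycle.cycleIntegral_succ (hγB : IsBCycle τ γB) (hγA : IsACycle τ γA) (n : ℕ) :
    cycleIntegral τ γB (n + 1) =
      τ * cycleIntegral τ γA (n + 1) + 1 / (2 * Real.pi * Complex.I) * L n τ := by
  rw [hγA.cycleIntegral_succ, hγB.recursion.eq_recSol, recSol_eq_combination,
    hγB.cycleIntegral_zero, hγB.cycleIntegral_one, K, L]
  ring

end SU3

namespace SU3

/-! ## Triple series -/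

open Finset

/-- Triples of natural numbers, grouped by their sum. -/
def sigmaTripleEquiv :
    (Σ N : ℕ, Σ p : antidiagonal N, antidiagonal p.1.2) ≃ ℕ × ℕ × ℕ where
  toFun x := (x.2.1.1.1, x.2.2.1.1, x.2.2.1.2)
  invFun p := ⟨p.1 + (p.2.1 + p.2.2), ⟨(p.1, p.2.1 + p.2.2), mem_antidiagonal.mpr rfl⟩,
    ⟨(p.2.1, p.2.2), mem_antidiagonal.mpr rfl⟩⟩
  left_inv := by
    rintro ⟨N, ⟨⟨k, s⟩, hp⟩, ⟨⟨l, m⟩, hq⟩⟩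
    obtain rfl := mem_antidiagonal.mp hq
    obtain rfl := mem_antidiagonal.mp hp
    rfl
  right_inv _ := rfl

section AntidiagonalSum

variable {M : Type*} [AddCommMonoid M]

/-- The sum of `f` over the triples `(k, l, m)` with `k + l + m = N`. -/
def antidiagonalSum (f : ℕ × ℕ × ℕ → M) (N : ℕ) : M :=
  ∑ p ∈ antidiagonal N, ∑ q ∈ antidiagonal p.2, f (p.1, q.1, q.2)

lemma antidiagonalSum_congr {f g : ℕ × ℕ × ℕ → M} {N : ℕ}
    (h : ∀ k l m, k + l + m = N → f (k, l, m) = g (k, l, m)) :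
    antidiagonalSum f N = antidiagonalSum g N :=
  sum_congr rfl fun p hp => sum_congr rfl fun q hq => h _ _ _ <| by
    rw [add_assoc, mem_antidiagonal.mp hq, mem_antidiagonal.mp hp]

lemma sum_sigmaTripleEquiv (f : ℕ × ℕ × ℕ → M) (N : ℕ) :
    ∑ x : (Σ p : antidiagonal N, antidiagonal p.1.2), f (sigmaTripleEquiv ⟨N, x⟩) =
      antidiagonalSum f N := by
  rw [Fintype.sum_sigma, antidiagonalSum, ← sum_coe_sort (antidiagonal N)]
  refine sum_congr rfl fun p _ => ?_
  rw [← sum_coe_sort (antidiagonal p.1.2)]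
  rfl

lemma hasSum_of_hasSum_antidiagonalSum [TopologicalSpace M] [ContinuousAdd M] [T3Space M]
    {f : ℕ × ℕ × ℕ → M} (hf : Summable f) {S : M} (h : HasSum (antidiagonalSum f) S) :
    HasSum f S := by
  have h_sigma : HasSum (antidiagonalSum f) (∑' p, f p) :=
    (sigmaTripleEquiv.hasSum_iff.mpr hf.hasSum).sigma fun N => by
      rw [← sum_sigmaTripleEquiv]
      exact hasSum_fintype _
  exact h.unique h_sigma ▸ hf.hasSum

end AntidiagonalSum

lemma summable_of_summable_antidiagonalSum {f : ℕ × ℕ × ℕ → ℝ} (hf : 0 ≤ f)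
    (h : Summable (antidiagonalSum f)) : Summable f := by
  rw [← sigmaTripleEquiv.summable_iff,
    summable_sigma_of_nonneg (f := f ∘ sigmaTripleEquiv) fun x => hf _]
  refine ⟨fun N => (hasSum_fintype _).summable, h.congr fun N => ?_⟩
  rw [tsum_fintype, ← sum_sigmaTripleEquiv]
  rfl

section Trinomial

variable {F : Type*} [Field F]

/-- The term of the expansion of `(x + y + z) ^ (k + l + m)` belonging to `x ^ k * y ^ l * z ^ m`,
indexed by `p = (k, l, m)`. -/
def trinomialTerm (x y z : F) (p : ℕ × ℕ × ℕ) : F :=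
  (p.1 + p.2.1 + p.2.2).factorial / (p.1.factorial * p.2.1.factorial * p.2.2.factorial) *
    (x ^ p.1 * y ^ p.2.1 * z ^ p.2.2)

lemma antidiagonalSum_trinomialTerm [CharZero F] (x y z : F) (N : ℕ) :
    antidiagonalSum (trinomialTerm x y z) N = (x + y + z) ^ N := by
  rw [add_assoc, (Commute.all x (y + z)).add_pow', antidiagonalSum]
  refine sum_congr rfl fun p hp => ?_
  rw [(Commute.all y z).add_pow', mul_sum, smul_sum]
  refine sum_congr rfl fun q hq => ?_
  obtain ⟨k, s⟩ := p
  obtain ⟨l, m⟩ := q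
  obtain rfl := mem_antidiagonal.mp hq
  obtain rfl := mem_antidiagonal.mp hp
  have h_ne (n : ℕ) : (n.factorial : F) ≠ 0 := Nat.cast_ne_zero.mpr n.factorial_ne_zero
  simp only [trinomialTerm, nsmul_eq_mul, Nat.cast_add_choose, add_assoc]
  field_simp [h_ne (l + m)]

end Trinomial

lemma norm_trinomialTerm (x y z : ℂ) (p : ℕ × ℕ × ℕ) :
    ‖trinomialTerm x y z p‖ = trinomialTerm ‖x‖ ‖y‖ ‖z‖ p := by
  simp [trinomialTerm]

lemma trinomialTerm_nonneg {x y z : ℝ} (hx : 0 ≤ x) (hy : 0 ≤ y) (hz : 0 ≤ z) :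
    0 ≤ trinomialTerm x y z := fun p => by
  simp only [trinomialTerm, Pi.zero_apply]
  positivity

lemma trinomialTerm_le_trinomialTerm {x y z x' y' z' : ℝ} (hx : 0 ≤ x) (hy : 0 ≤ y) (hz : 0 ≤ z)
    (hxx' : x ≤ x') (hyy' : y ≤ y') (hzz' : z ≤ z') (p : ℕ × ℕ × ℕ) :
    trinomialTerm x y z p ≤ trinomialTerm x' y' z' p := by
  have := hx.trans hxx'
  have := hy.trans hyy'
  simp only [trinomialTerm]
  gcongr

lemma summable_trinomialTerm {x y z : ℝ} (hx : 0 ≤ x) (hy : 0 ≤ y) (hz : 0 ≤ z)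
    (h : x + y + z < 1) : Summable (trinomialTerm x y z) := by
  refine summable_of_summable_antidiagonalSum (trinomialTerm_nonneg hx hy hz) ?_
  rw [funext (antidiagonalSum_trinomialTerm x y z)]
  exact summable_geometric_of_lt_one (by positivity) h

/-! ## The binomial series of `(1 - z) ^ (-1/2)` -/

/-- The coefficient of `z ^ N` in `(1 - z) ^ (-1/2)`, in the form in which it enters the series of
the periods. -/
noncomputable def rsqrtCoeff (N : ℕ) : ℝ := Real.Gamma (N + 1 / 2) / (√Real.pi * N.factorial)

lemma rsqrtCoeff_nonneg (N : ℕ) : 0 ≤ rsqrtCoeff N :=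
  div_nonneg (Real.Gamma_pos_of_pos (by positivity)).le (by positivity)

lemma rsqrtCoeff_zero : rsqrtCoeff 0 = 1 := by
  simp [rsqrtCoeff, Real.Gamma_one_half_eq, -one_div, (Real.sqrt_pos.mpr Real.pi_pos).ne']

lemma succ_mul_rsqrtCoeff_succ (N : ℕ) :
    (N + 1) * rsqrtCoeff (N + 1) = (N + 1 / 2) * rsqrtCoeff N := by
  have h_Gamma : Real.Gamma ((N + 1 : ℕ) + 1 / 2) = (N + 1 / 2) * Real.Gamma (N + 1 / 2) := by
    rw [← Real.Gamma_add_one (by positivity), Nat.cast_succ, add_right_comm]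
  rw [rsqrtCoeff, rsqrtCoeff, h_Gamma, Nat.factorial_succ]
  push_cast
  field_simp

lemma rsqrtCoeff_le_one (N : ℕ) : rsqrtCoeff N ≤ 1 := by
  induction N with
  | zero => exact rsqrtCoeff_zero.le
  | succ N ih =>
    nlinarith [succ_mul_rsqrtCoeff_succ N]

lemma factorial_mul_rsqrtCoeff (N : ℕ) :
    (N.factorial : ℂ) * rsqrtCoeff N = (ascPochhammer ℂ N).eval (1 / 2) := by
  induction N with
  | zero => simp [rsqrtCoeff_zero]
  | succ N ih =>
    have h_succ := congrArg ((↑) : ℝ → ℂ) (succ_mul_rsqrtCoeff_succ N)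
    push_cast at h_succ
    rw [ascPochhammer_succ_eval, ← ih, Nat.factorial_succ]
    push_cast
    linear_combination (N.factorial : ℂ) * h_succ

lemma ringChoose_half_add_sub_one (N : ℕ) :
    Ring.choose ((1 / 2 : ℂ) + N - 1) N = rsqrtCoeff N := by
  have h_multichoose : Ring.choose ((1 / 2 : ℂ) + N - 1) N = Ring.multichoose (1 / 2 : ℂ) N := by
    rw [Ring.choose]
    ring_nf
  have h_pochhammer := Ring.factorial_nsmul_multichoose_eq_ascPochhammer (1 / 2 : ℂ) N
  rw [Polynomial.ascPochhammer_smeval_eq_eval, ← factorial_mul_rsqrtCoeff, nsmul_eq_mul]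
    at h_pochhammer
  rw [h_multichoose]
  exact mul_left_cancel₀ (Nat.cast_ne_zero.mpr N.factorial_ne_zero) h_pochhammer

lemma hasSum_rsqrtCoeff_mul_pow {z : ℂ} (hz : ‖z‖ < 1) :
    HasSum (fun N : ℕ => rsqrtCoeff N * z ^ N) (1 / (1 - z) ^ (1 / 2 : ℂ)) := by
  have h := (Complex.one_div_one_sub_cpow_hasFPowerSeriesOnBall_zero (1 / 2)).hasSum (y := z)
    (by simpa [enorm_eq_nnnorm, ← NNReal.coe_lt_coe] using hz)
  rw [zero_add] at h
  refine h.congr_fun fun N => ?_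
  rw [FormalMultilinearSeries.ofScalars_apply_eq, ringChoose_half_add_sub_one, smul_eq_mul]

open Metric Topology in
lemma hasSumLocallyUniformlyOn_rsqrtCoeff_mul_pow :
    HasSumLocallyUniformlyOn (fun (N : ℕ) z => (rsqrtCoeff N : ℂ) * z ^ N)
      (fun z => 1 / (1 - z) ^ (1 / 2 : ℂ)) (ball 0 1) := by
  refine hasSumLocallyUniformlyOn_of_of_forall_exists_nhds fun z hz => ?_
  obtain ⟨r, hzr, hr⟩ := exists_between (mem_ball_zero_iff.mp hz)
  have hr_nonneg : 0 ≤ r := (norm_nonneg z).trans hzr.le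
  have h_bound : ∀ (N : ℕ), ∀ x ∈ ball (0 : ℂ) r, ‖(rsqrtCoeff N : ℂ) * x ^ N‖ ≤ r ^ N :=
    fun N x hx => by
      rw [norm_mul, norm_pow, Complex.norm_of_nonneg (rsqrtCoeff_nonneg N)]
      exact (mul_le_of_le_one_left (by positivity) (rsqrtCoeff_le_one N)).trans
        (pow_le_pow_left₀ (norm_nonneg x) (mem_ball_zero_iff.mp hx).le N)
  refine ⟨ball 0 r, mem_nhdsWithin_of_mem_nhds (isOpen_ball.mem_nhds (by simpa using hzr)), ?_⟩
  exact (HasSumUniformlyOn.of_norm_le_summable (summable_geometric_of_lt_one hr_nonneg hr)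
    h_bound).congr_right fun x hx =>
      (hasSum_rsqrtCoeff_mul_pow ((mem_ball_zero_iff.mp hx).trans hr)).tsum_eq

/-! ## The series of the periods in the units `2ω = 1` -/

/-- The coefficients of the series of the periods after rescaling `2ω` to `1` and splitting off
`√π`. They expand `(1 - (x³ - u x + v) / 2) ^ (-1/2)` in powers of `x`. -/
noncomputable def normCoeff (u v : ℂ) (p : ℕ × ℕ × ℕ) : ℂ :=
  rsqrtCoeff (p.1 + p.2.1 + p.2.2) * trinomialTerm (1 / 2) (-u / 2) (v / 2) p

/-- The general term of the series of the periods in the units `2ω = 1`, where `j` stands for the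
integrals of the powers of `x`. -/
noncomputable def normTerm (u v : ℂ) (j : ℕ → ℂ) (p : ℕ × ℕ × ℕ) : ℂ :=
  normCoeff u v p * (3 * j (3 * p.1 + p.2.1 + 3) - u * j (3 * p.1 + p.2.1 + 1))

lemma norm_normCoeff_le {u v : ℂ} {a b : ℝ} (hu : ‖u‖ ≤ a) (hv : ‖v‖ ≤ b) (p : ℕ × ℕ × ℕ) :
    ‖normCoeff u v p‖ ≤ trinomialTerm (1 / 2) (a / 2) (b / 2) p := by
  rw [normCoeff, norm_mul, Complex.norm_of_nonneg (rsqrtCoeff_nonneg _), norm_trinomialTerm]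
  simp only [norm_div, norm_neg, norm_one, Complex.norm_ofNat]
  exact (mul_le_of_le_one_left (trinomialTerm_nonneg (by positivity) (by positivity)
    (by positivity) p) (rsqrtCoeff_le_one _)).trans (trinomialTerm_le_trinomialTerm (by positivity)
      (by positivity) (by positivity) le_rfl (by gcongr) (by gcongr) p)

lemma norm_normTerm_le {u v : ℂ} {j : ℕ → ℂ} {a b M : ℝ} (hu : ‖u‖ ≤ a) (hv : ‖v‖ ≤ b)
    (ha : a ≤ 1) (hj : ∀ n, ‖j n‖ ≤ M) (p : ℕ × ℕ × ℕ) :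
    ‖normTerm u v j p‖ ≤ trinomialTerm (1 / 2) (a / 2) (b / 2) p * (4 * M) := by
  have h_le (k n : ℕ) : ‖3 * j k - u * j n‖ ≤ 4 * M := by
    calc ‖3 * j k - u * j n‖ ≤ 3 * ‖j k‖ + ‖u‖ * ‖j n‖ := by
          simpa only [norm_mul, Complex.norm_ofNat] using norm_sub_le (3 * j k) (u * j n)
      _ ≤ 3 * M + 1 * M := by gcongr; exacts [hj k, hu.trans ha, hj n]
      _ = 4 * M := by ring
  rw [normTerm, norm_mul]
  exact mul_le_mul (norm_normCoeff_le hu hv p) (h_le _ _) (norm_nonneg _)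
    ((norm_nonneg _).trans (norm_normCoeff_le hu hv p))

lemma summable_normTerm {u v : ℂ} (huv : ‖u‖ + ‖v‖ < 1) {j : ℕ → ℂ} {M : ℝ}
    (hj : ∀ n, ‖j n‖ ≤ M) : Summable (normTerm u v j) := by
  have hu : ‖u‖ ≤ 1 := by linarith [norm_nonneg v]
  exact Summable.of_norm_bounded ((summable_trinomialTerm (by norm_num) (by positivity)
    (by positivity) (by linarith)).mul_right _) (norm_normTerm_le le_rfl le_rfl hu hj)

lemma antidiagonalSum_normTerm_pow (u v x : ℂ) (N : ℕ) :
    antidiagonalSum (normTerm u v (x ^ ·)) N =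
      rsqrtCoeff N * ((x ^ 3 - u * x + v) / 2) ^ N * (3 * x ^ 3 - u * x) := by
  have h_term : antidiagonalSum (normTerm u v (x ^ ·)) N = antidiagonalSum (fun p =>
      rsqrtCoeff N * (3 * x ^ 3 - u * x) * trinomialTerm (x ^ 3 / 2) (-u * x / 2) (v / 2) p) N := by
    refine antidiagonalSum_congr fun k l m h => ?_
    subst h
    simp only [normTerm, normCoeff, trinomialTerm, div_pow, mul_pow, pow_add, pow_mul]
    ring
  rw [h_term]
  have h_sum : (x ^ 3 - u * x + v) / 2 = x ^ 3 / 2 + -u * x / 2 + v / 2 := by ring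
  rw [h_sum, ← antidiagonalSum_trinomialTerm]
  simp only [antidiagonalSum, mul_sum, sum_mul]
  refine sum_congr rfl fun p _ => sum_congr rfl fun q _ => by ring

section Rescaling

variable {τ : ℍ} {w : ℂ}

lemma g₂_eq_modU (hw : w ≠ 0) : g₂ τ = w ^ 4 * (4 * modU τ w) := by
  rw [modU]; field_simp

lemma g₃_eq_modV (hw : w ≠ 0) : g₃ τ = w ^ 6 * (-4 * modV τ w) := by
  rw [modV]; field_simp

lemma coeff_eq_normCoeff (hw : w ≠ 0) (k l m : ℕ) :
    coeff τ w k l m =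
      √Real.pi * normCoeff (modU τ w) (modV τ w) (k, l, m) / w ^ (6 * k + 2 * l + 5) := by
  have h_sqrt : (√Real.pi : ℂ) ≠ 0 := by
    exact_mod_cast (Real.sqrt_pos.mpr Real.pi_pos).ne'
  have h_sign : (-1 : ℂ) ^ (l + m) * g₂ τ ^ l * g₃ τ ^ m =
      4 ^ (l + m) * w ^ (4 * l + 6 * m) * ((-modU τ w) ^ l * modV τ w ^ m) := by
    rw [g₂_eq_modU hw, g₃_eq_modV hw]
    calc (-1 : ℂ) ^ (l + m) * (w ^ 4 * (4 * modU τ w)) ^ l * (w ^ 6 * (-4 * modV τ w)) ^ m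
        = (-1 * (w ^ 4 * (4 * modU τ w))) ^ l * (-1 * (w ^ 6 * (-4 * modV τ w))) ^ m := by
          rw [mul_pow (-1), mul_pow (-1)]; ring
      _ = (4 * w ^ 4 * -modU τ w) ^ l * (4 * w ^ 6 * modV τ w) ^ m := by congr 2 <;> ring
      _ = _ := by simp only [mul_pow]; ring
  have h_fact : ((k + l + m).factorial : ℂ) ≠ 0 := Nat.cast_ne_zero.mpr (Nat.factorial_ne_zero _)
  have h_two : (2 : ℂ) ^ (k + 3 * l + 3 * m) = 2 ^ k * 2 ^ l * 2 ^ m * 4 ^ (l + m) := by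
    rw [show (4 : ℂ) = 2 ^ 2 by norm_num, ← pow_mul]; ring
  have h_pow : w ^ (6 * (k + l + m) + 5) = w ^ (4 * l + 6 * m) * w ^ (6 * k + 2 * l + 5) := by ring
  rw [coeff, h_sign, h_two, h_pow, normCoeff, rsqrtCoeff, trinomialTerm]
  generalize -modU τ w = u'
  simp only [div_pow, one_pow]
  push_cast
  field_simp

lemma sqrt_two_div_pi_mul_sqrt_pi : (√(2 / Real.pi) : ℂ) * √Real.pi = √2 := by
  rw [← Complex.ofReal_mul, ← Real.sqrt_mul (by positivity), div_mul_cancel₀ _ Real.pi_ne_zero]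

lemma periodTerm_eq_normTerm (hw : w ≠ 0) {J j : ℕ → ℂ} (hJ : ∀ n, J n = w ^ (2 * n) * j n)
    (p : ℕ × ℕ × ℕ) :
    periodTerm τ w J p = -Complex.I * √2 * w * normTerm (modU τ w) (modV τ w) j p := by
  obtain ⟨k, l, m⟩ := p
  rw [periodTerm, coeff_eq_normCoeff hw, normTerm, hJ, hJ, g₂_eq_modU hw,
    ← sqrt_two_div_pi_mul_sqrt_pi]
  field_simp
  ring

end Rescaling

end SU3

namespace SU3

section Convergence

variable {τ : ℍ} {w : ℂ}

lemma recSol_g₂_g₃_eq (hw : w ≠ 0) (a b : ℂ) (n : ℕ) :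
    recSol (g₂ τ) (g₃ τ) a b n =
      w ^ (2 * n) * recSol (4 * modU τ w) (-4 * modV τ w) a (b / w ^ 2) n := by
  rw [← recSol_scale, ← g₂_eq_modU hw, ← g₃_eq_modV hw, mul_div_cancel₀ _ (pow_ne_zero 2 hw)]

lemma InDomain.summable_periodTerm (h : InDomain τ w) {J : ℕ → ℂ}
    (hJ : Recursion (g₂ τ) (g₃ τ) J) : Summable (periodTerm τ w J) := by
  have h_scale (n : ℕ) := (hJ.eq_recSol n).trans (recSol_g₂_g₃_eq h.1 _ _ n)
  rw [funext (periodTerm_eq_normTerm h.1 h_scale)]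
  exact (summable_normTerm h.2 (norm_recSol_le h.2.le _ _)).mul_left _

lemma neg_two_div_two_pi_rpow_eq :
    ((-2 / (2 * Real.pi) ^ (3 / 2 : ℝ) : ℝ) : ℂ) =
      -Complex.I * √(2 / Real.pi) * (1 / (2 * Real.pi * Complex.I)) := by
  have h_rpow : (2 * Real.pi) ^ (3 / 2 : ℝ) = √2 * (√Real.pi * (2 * Real.pi)) := by
    rw [show (3 / 2 : ℝ) = 1 / 2 + 1 by norm_num, Real.rpow_add_one (by positivity),
      ← Real.sqrt_eq_rpow, Real.sqrt_mul zero_le_two, mul_assoc]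
  have h_real : -2 / (2 * Real.pi) ^ (3 / 2 : ℝ) = -(√(2 / Real.pi) * (1 / (2 * Real.pi))) := by
    rw [h_rpow, Real.sqrt_div zero_le_two]
    field_simp
    rw [Real.sq_sqrt zero_le_two]
  have hI := Complex.I_ne_zero
  rw [h_real]
  push_cast
  field_simp

lemma modularTerm_eq_periodTerm (p : ℕ × ℕ × ℕ) :
    modularTerm τ w p = periodTerm τ w
      (fun n => 1 / (2 * Real.pi * Complex.I) * recSol (g₂ τ) (g₃ τ) 0 1 n) p := by
  simp only [modularTerm, periodTerm, L, neg_two_div_two_pi_rpow_eq]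
  ring

lemma modularTerm_eq_normTerm (hw : w ≠ 0) (p : ℕ × ℕ × ℕ) :
    modularTerm τ w p = -(√2 * Real.pi * w)⁻¹ *
      normTerm (modU τ w) (modV τ w) (recSol (4 * modU τ w) (-4 * modV τ w) 0 1) p := by
  have h_scale (n : ℕ) : 1 / (2 * Real.pi * Complex.I) * recSol (g₂ τ) (g₃ τ) 0 1 n =
      w ^ (2 * n) * (1 / (2 * Real.pi * Complex.I * w ^ 2) *
        recSol (4 * modU τ w) (-4 * modV τ w) 0 1 n) := by
    rw [recSol_g₂_g₃_eq hw, recSol_eq_combination _ _ 0 (1 / w ^ 2)]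
    field_simp
    ring
  have hI := Complex.I_ne_zero
  have h_sqrt : (√2 : ℂ) ^ 2 = 2 := mod_cast Real.sq_sqrt zero_le_two
  have h_sqrt_ne : (√2 : ℂ) ≠ 0 := mod_cast (Real.sqrt_pos.mpr zero_lt_two).ne'
  rw [modularTerm_eq_periodTerm, periodTerm_eq_normTerm hw h_scale, normTerm, normTerm]
  field_simp
  rw [h_sqrt]
  ring

lemma InDomain.summable_modularTerm (h : InDomain τ w) : Summable (modularTerm τ w) := by
  rw [funext (modularTerm_eq_normTerm h.1)]
  exact (summable_normTerm h.2 (norm_recSol_le h.2.le 0 1)).mul_left _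

end Convergence

/-! ## The parametrisation of the curve -/

section Curve

variable {τ : ℍ} {w z : ℂ}

lemma smallFactor_eq (hw : w ≠ 0) (hz : z ∉ (periods τ).lattice) :
    smallFactor τ w z = wp' τ z ^ 2 / (4 * w ^ 6) := by
  rw [wp'_sq hz, smallFactor, coordX, modU, modV]
  field_simp
  ring

lemma swA_coordX : swA (modU τ w) (modV τ w) (coordX τ w z) = smallFactor τ w z - 1 := by
  rw [swA, smallFactor]
  ring

lemma hasDerivAt_swA (u v x : ℂ) : HasDerivAt (swA u v) (3 * x ^ 2 - u) x :=
  (((hasDerivAt_id x).pow 3).sub ((hasDerivAt_id x).const_mul u)).sub_const (1 - v)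
    |>.congr_deriv (by simp)

lemma coord_mem_swCurve (hw : w ≠ 0) (hz : z ∉ (periods τ).lattice) :
    (coordX τ w z, coordY τ w z) ∈ swCurve (modU τ w) (modV τ w) := by
  have h_sqrt : (√2 : ℂ) ^ 2 = 2 := mod_cast Real.sq_sqrt zero_le_two
  have h_cpow : ((1 - smallFactor τ w z / 2) ^ (1 / 2 : ℂ)) ^ 2 = 1 - smallFactor τ w z / 2 := by
    rw [one_div]
    exact Complex.cpow_nat_inv_pow _ two_ne_zero
  have h_sq : coordY τ w z ^ 2 =
      -2 * (wp' τ z ^ 2 / (4 * w ^ 6)) * (1 - smallFactor τ w z / 2) := by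
    rw [coordY, mul_pow, h_cpow, div_pow, mul_pow, mul_pow, h_sqrt, Complex.I_sq]
    field_simp
    ring
  rw [swCurve, Set.mem_ofPred_eq, swA_coordX, h_sq, ← smallFactor_eq hw hz]
  ring

lemma norm_half_smallFactor_lt_one (h : ‖smallFactor τ w z‖ < 2) :
    ‖smallFactor τ w z / 2‖ < 1 := by
  rw [norm_div, Complex.norm_ofNat]
  linarith

lemma one_sub_half_smallFactor_mem_slitPlane (h : ‖smallFactor τ w z‖ < 2) :
    1 - smallFactor τ w z / 2 ∈ Complex.slitPlane := by
  rw [sub_eq_add_neg]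
  exact Complex.mem_slitPlane_of_norm_lt_one (by
    rw [norm_neg]; exact norm_half_smallFactor_lt_one h)

lemma one_sub_half_smallFactor_cpow_ne_zero (h : ‖smallFactor τ w z‖ < 2) :
    (1 - smallFactor τ w z / 2) ^ (1 / 2 : ℂ) ≠ 0 :=
  fun h_zero => Complex.slitPlane_ne_zero (one_sub_half_smallFactor_mem_slitPlane h)
    (Complex.cpow_eq_zero_iff _ _ |>.mp h_zero).1

lemma coordY_ne_zero (hw : w ≠ 0) (hz : wp' τ z ≠ 0) (h : ‖smallFactor τ w z‖ < 2) :
    coordY τ w z ≠ 0 := by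
  have h_sqrt : (√2 : ℂ) ≠ 0 := mod_cast (Real.sqrt_pos.mpr zero_lt_two).ne'
  exact mul_ne_zero (div_ne_zero (mul_ne_zero Complex.I_ne_zero hz)
    (mul_ne_zero h_sqrt (pow_ne_zero 3 hw))) (one_sub_half_smallFactor_cpow_ne_zero h)

end Curve

namespace IsCycle

variable {τ : ℍ} {c w : ℂ} {γ : ℝ → ℂ}

lemma wp'_ne_zero (hγ : IsCycle τ c γ) (hw : w ≠ 0) (hs : IsShort τ w γ) {t : ℝ}
    (ht : t ∈ Set.Icc (0 : ℝ) 1) : wp' τ (γ t) ≠ 0 := fun h => by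
  have h_pos := (hs t ht).1
  rw [smallFactor_eq hw (hγ.avoids t ht), h] at h_pos
  simp at h_pos

lemma continuousOn_coordX (hγ : IsCycle τ c γ) :
    ContinuousOn (fun t => coordX τ w (γ t)) (Set.uIcc 0 1) :=
  hγ.continuousOn_wp.div_const _

lemma continuousOn_smallFactor (hγ : IsCycle τ c γ) :
    ContinuousOn (fun t => smallFactor τ w (γ t)) (Set.uIcc 0 1) :=
  ((hγ.continuousOn_coordX.pow 3).sub (hγ.continuousOn_coordX.const_mul _)).add_const _

lemma isClosedPath (hγ : IsCycle τ c γ) (hc : c ∈ (periods τ).lattice) (hw : w ≠ 0)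
    (hs : IsShort τ w γ) :
    IsClosedPath (modU τ w) (modV τ w) (fun t => coordX τ w (γ t))
      (fun t => coordY τ w (γ t)) := by
  have h_Icc : Set.uIcc (0 : ℝ) 1 = Set.Icc 0 1 := Set.uIcc_of_le zero_le_one
  have h_wp : wp τ (γ 1) = wp τ (γ 0) := by
    rw [hγ.end_eq]; exact (periods τ).weierstrassP_add_coe (γ 0) ⟨c, hc⟩
  have h_wp' : wp' τ (γ 1) = wp' τ (γ 0) := by
    rw [hγ.end_eq]; exact (periods τ).derivWeierstrassP_add_coe (γ 0) ⟨c, hc⟩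
  exact
    { continuousOn_x := h_Icc ▸ hγ.continuousOn_coordX
      continuousOn_y := h_Icc ▸ ((hγ.continuousOn_wp'.const_mul _).div_const _).mul
        ((continuousOn_const.sub (hγ.continuousOn_smallFactor.div_const _)).cpow
          continuousOn_const fun t ht =>
            one_sub_half_smallFactor_mem_slitPlane (hs t (h_Icc ▸ ht)).2)
      mem := fun t ht => coord_mem_swCurve hw (hγ.avoids t ht)
      y_ne := fun t ht => coordY_ne_zero hw (hγ.wp'_ne_zero hw hs ht) (hs t ht).2
      x_end := by simp only [coordX, h_wp]
      y_end := by simp only [coordY, smallFactor, coordX, h_wp, h_wp'] }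

lemma exists_isShort (hγ : IsCycle τ c γ) (h_ne : ∀ t ∈ Set.Icc (0 : ℝ) 1, wp' τ (γ t) ≠ 0) :
    ∃ R : ℝ, ∀ w : ℂ, R < ‖w‖ → InDomain τ w ∧ IsShort τ w γ := by
  obtain ⟨C, hC⟩ := isCompact_uIcc.exists_bound_of_continuousOn hγ.continuousOn_wp'
  refine ⟨1 + ‖g₂ τ‖ + ‖g₃ τ‖ + C ^ 2, fun w hw => ?_⟩
  have hg₂ := norm_nonneg (g₂ τ)
  have hg₃ := norm_nonneg (g₃ τ)
  have hC_sq := sq_nonneg C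
  have hw_one : 1 < ‖w‖ := by linarith
  have hw_ne : w ≠ 0 := norm_pos_iff.mp (by linarith)
  have hw_four : ‖w‖ ≤ ‖w‖ ^ 4 := le_self_pow₀ hw_one.le (by norm_num)
  have hw_six : ‖w‖ ≤ ‖w‖ ^ 6 := le_self_pow₀ hw_one.le (by norm_num)
  refine ⟨⟨hw_ne, ?_⟩, fun t ht => ?_⟩
  · have hu : ‖modU τ w‖ < 1 / 2 := by
      rw [modU, norm_div, norm_mul, norm_pow, Complex.norm_ofNat, div_lt_iff₀ (by positivity)]
      linarith
    have hv : ‖modV τ w‖ < 1 / 2 := by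
      rw [modV, norm_div, norm_neg, norm_mul, norm_pow, Complex.norm_ofNat,
        div_lt_iff₀ (by positivity)]
      linarith
    linarith
  · have h_pos : 0 < ‖wp' τ (γ t)‖ := norm_pos_iff.mpr (h_ne t ht)
    have h_le : ‖wp' τ (γ t)‖ ^ 2 ≤ C ^ 2 := by
      gcongr; exact hC t (Set.Icc_subset_uIcc ht)
    rw [smallFactor_eq hw_ne (hγ.avoids t ht)]
    simp only [norm_div, norm_mul, norm_pow, Complex.norm_ofNat]
    refine ⟨by positivity, ?_⟩
    rw [div_lt_iff₀ (by positivity)]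
    linarith

end IsCycle

/-! ## The periods as series -/

open Finset in
lemma antidiagonalSum_normTerm_integral (u v : ℂ) {X d : ℝ → ℂ} {a b : ℝ}
    (hX : ContinuousOn X (Set.uIcc a b)) (hd : ContinuousOn d (Set.uIcc a b)) (N : ℕ) :
    antidiagonalSum (normTerm u v fun n => ∫ t in a..b, X t ^ n * d t) N =
      ∫ t in a..b, antidiagonalSum (normTerm u v (X t ^ ·)) N * d t := by
  have h_int (n : ℕ) : IntervalIntegrable (fun t => X t ^ n * d t) MeasureTheory.volume a b :=
    ((hX.pow n).mul hd).intervalIntegrable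
  have h_term (p : ℕ × ℕ × ℕ) (t : ℝ) : normTerm u v (X t ^ ·) p * d t =
      normCoeff u v p * (3 * (X t ^ (3 * p.1 + p.2.1 + 3) * d t) -
        u * (X t ^ (3 * p.1 + p.2.1 + 1) * d t)) := by
    rw [normTerm]
    ring
  have h_int_term (p : ℕ × ℕ × ℕ) : IntervalIntegrable (fun t => normTerm u v (X t ^ ·) p * d t)
      MeasureTheory.volume a b := by
    simp only [h_term]
    exact (((h_int _).const_mul _).sub ((h_int _).const_mul _)).const_mul _
  simp only [← sum_sigmaTripleEquiv, sum_mul]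
  rw [intervalIntegral.integral_finsetSum fun p _ => h_int_term _]
  refine sum_congr rfl fun p _ => ?_
  simp only [h_term]
  rw [intervalIntegral.integral_const_mul, intervalIntegral.integral_sub
    ((h_int _).const_mul _) ((h_int _).const_mul _), intervalIntegral.integral_const_mul,
    intervalIntegral.integral_const_mul, normTerm]

namespace IsCycle

variable {τ : ℍ} {c w : ℂ} {γ : ℝ → ℂ}

lemma shortPeriod_integrand (hγ : IsCycle τ c γ) (hw : w ≠ 0) (hs : IsShort τ w γ) {t : ℝ}
    (ht : t ∈ Set.Icc (0 : ℝ) 1) :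
    coordX τ w (γ t) * deriv (swA (modU τ w) (modV τ w)) (coordX τ w (γ t)) *
        deriv (fun t => coordX τ w (γ t)) t / coordY τ w (γ t) =
      -Complex.I * √2 * w * (1 / (1 - smallFactor τ w (γ t) / 2) ^ (1 / 2 : ℂ) *
        ((3 * coordX τ w (γ t) ^ 3 - modU τ w * coordX τ w (γ t)) * deriv γ t)) := by
  have h_deriv : deriv (fun t => coordX τ w (γ t)) t = wp' τ (γ t) * deriv γ t / w ^ 2 :=
    (((hasDerivAt_wp (hγ.avoids t ht)).comp t (hγ.hasDerivAt t)).div_const _).deriv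
  have h_wp' := hγ.wp'_ne_zero hw hs ht
  have h_sqrt : (√2 : ℂ) ≠ 0 := mod_cast (Real.sqrt_pos.mpr zero_lt_two).ne'
  have hI := Complex.I_ne_zero
  rw [h_deriv, (hasDerivAt_swA _ _ _).deriv, coordY]
  field_simp
  rw [Complex.I_sq]
  ring

lemma hasSum_integral_rsqrtCoeff (hγ : IsCycle τ c γ) (hs : IsShort τ w γ) {g : ℝ → ℂ}
    (hg : ContinuousOn g (Set.uIcc 0 1)) :
    HasSum (fun N => ∫ t in (0 : ℝ)..1, rsqrtCoeff N * (smallFactor τ w (γ t) / 2) ^ N * g t)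
      (∫ t in (0 : ℝ)..1, 1 / (1 - smallFactor τ w (γ t) / 2) ^ (1 / 2 : ℂ) * g t) := by
  have h_cont : ContinuousOn (fun t => smallFactor τ w (γ t) / 2) (Set.uIcc 0 1) :=
    hγ.continuousOn_smallFactor.div_const _
  have h_maps : Set.MapsTo (fun t => smallFactor τ w (γ t) / 2) (Set.uIcc 0 1)
      (Metric.ball 0 1) := fun t ht => by
    rw [Set.uIcc_of_le zero_le_one] at ht
    exact mem_ball_zero_iff.mpr (norm_half_smallFactor_lt_one (hs t ht).2)
  exact hasSum_intervalIntegral_mul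
    (hasSumLocallyUniformlyOn_rsqrtCoeff_mul_pow.comp _ h_maps h_cont)
    (fun N => continuousOn_const.mul (h_cont.pow N)) hg

lemma shortPeriod_eq (hγ : IsCycle τ c γ) (hw : w ≠ 0) (hs : IsShort τ w γ) :
    shortPeriod τ w γ = (2 * Real.pi * Complex.I)⁻¹ * (-Complex.I * √2 * w *
      ∫ t in (0 : ℝ)..1, 1 / (1 - smallFactor τ w (γ t) / 2) ^ (1 / 2 : ℂ) *
        ((3 * coordX τ w (γ t) ^ 3 - modU τ w * coordX τ w (γ t)) * deriv γ t)) := by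
  rw [shortPeriod, swPeriod, ← intervalIntegral.integral_const_mul (-Complex.I * √2 * w)]
  refine congrArg ((2 * Real.pi * Complex.I)⁻¹ * ·)
    (intervalIntegral.integral_congr fun t ht => ?_)
  rw [Set.uIcc_of_le zero_le_one] at ht
  exact hγ.shortPeriod_integrand hw hs ht

lemma periodTerm_cycleIntegral (hw : w ≠ 0) (p : ℕ × ℕ × ℕ) :
    periodTerm τ w (cycleIntegral τ γ) p =
      (2 * Real.pi * Complex.I)⁻¹ * (-Complex.I * √2 * w * normTerm (modU τ w) (modV τ w)
        (fun n => ∫ t in (0 : ℝ)..1, coordX τ w (γ t) ^ n * deriv γ t) p) := by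
  have h_scale (n : ℕ) : cycleIntegral τ γ n = w ^ (2 * n) * ((2 * Real.pi * Complex.I)⁻¹ *
      ∫ t in (0 : ℝ)..1, coordX τ w (γ t) ^ n * deriv γ t) := by
    rw [cycleIntegral, mul_left_comm, ← intervalIntegral.integral_const_mul (w ^ (2 * n))]
    refine congrArg ((2 * Real.pi * Complex.I)⁻¹ * ·)
      (intervalIntegral.integral_congr fun t _ => ?_)
    simp only [coordX, div_pow, ← pow_mul]
    field_simp
  rw [periodTerm_eq_normTerm hw h_scale, normTerm, normTerm]
  ring

lemma hasSum_periodTerm (hγ : IsCycle τ c γ) (hc : c ∈ (periods τ).lattice)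
    (hD : InDomain τ w) (hs : IsShort τ w γ) :
    HasSum (periodTerm τ w (cycleIntegral τ γ)) (shortPeriod τ w γ) := by
  have h_const : -Complex.I * √2 * w ≠ 0 :=
    mul_ne_zero (mul_ne_zero (neg_ne_zero.mpr Complex.I_ne_zero)
      (mod_cast (Real.sqrt_pos.mpr zero_lt_two).ne')) hD.1
  have h_summable := hD.summable_periodTerm (hγ.recursion_cycleIntegral hc)
  have h_deriv : ContinuousOn (deriv γ) (Set.uIcc 0 1) := hγ.continuous_deriv.continuousOn
  rw [funext (periodTerm_cycleIntegral hD.1)] at h_summable ⊢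
  rw [summable_mul_left_iff (inv_ne_zero Complex.two_pi_I_ne_zero),
    summable_mul_left_iff h_const] at h_summable
  rw [hγ.shortPeriod_eq hD.1 hs]
  refine ((hasSum_of_hasSum_antidiagonalSum h_summable ?_).mul_left _).mul_left _
  refine (hγ.hasSum_integral_rsqrtCoeff hs (((continuousOn_const.mul
    (hγ.continuousOn_coordX.pow 3)).sub (hγ.continuousOn_coordX.const_mul _)).mul
      h_deriv)).congr_fun fun N => ?_
  rw [antidiagonalSum_normTerm_integral _ _ hγ.continuousOn_coordX h_deriv]
  simp only [antidiagonalSum_normTerm_pow, smallFactor, mul_assoc]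
  rfl

end IsCycle

section Difference

variable {τ : ℍ} {w : ℂ} {γA γB : ℝ → ℂ}

lemma IsACycle.isClosedPath (hγA : IsACycle τ γA) (hw : w ≠ 0) (hs : IsShort τ w γA) :
    IsClosedPath (modU τ w) (modV τ w) (fun t => coordX τ w (γA t))
      (fun t => coordY τ w (γA t)) :=
  IsCycle.isClosedPath hγA (two_pi_I_mem_lattice τ) hw hs

lemma IsBCycle.isClosedPath (hγB : IsBCycle τ γB) (hw : w ≠ 0) (hs : IsShort τ w γB) :
    IsClosedPath (modU τ w) (modV τ w) (fun t => coordX τ w (γB t))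
      (fun t => coordY τ w (γB t)) :=
  IsCycle.isClosedPath hγB (two_pi_I_mul_mem_lattice τ) hw hs

lemma IsACycle.hasSum_periodTerm (hγA : IsACycle τ γA) (hD : InDomain τ w)
    (hs : IsShort τ w γA) : HasSum (periodTerm τ w (cycleIntegral τ γA)) (shortPeriod τ w γA) :=
  IsCycle.hasSum_periodTerm hγA (two_pi_I_mem_lattice τ) hD hs

lemma IsBCycle.hasSum_periodTerm (hγB : IsBCycle τ γB) (hD : InDomain τ w)
    (hs : IsShort τ w γB) : HasSum (periodTerm τ w (cycleIntegral τ γB)) (shortPeriod τ w γB) :=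
  IsCycle.hasSum_periodTerm hγB (two_pi_I_mul_mem_lattice τ) hD hs

lemma hasSum_modularTerm (hD : InDomain τ w) (hγA : IsACycle τ γA) (hsA : IsShort τ w γA)
    (hγB : IsBCycle τ γB) (hsB : IsShort τ w γB) :
    HasSum (modularTerm τ w) (shortPeriod τ w γB - τ * shortPeriod τ w γA) := by
  refine ((hγB.hasSum_periodTerm hD hsB).sub
    ((hγA.hasSum_periodTerm hD hsA).mul_left (τ : ℂ))).congr_fun fun p => ?_
  rw [modularTerm, periodTerm, periodTerm, neg_two_div_two_pi_rpow_eq,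
    hγB.cycleIntegral_succ hγA (3 * p.1 + p.2.1 + 2), hγB.cycleIntegral_succ hγA (3 * p.1 + p.2.1)]
  ring

end Difference

/-! ## Holomorphy and modularity of `a_D - τ a` -/

open Metric in
lemma differentiableOn_tsum_of_summable_norm {ι E F : Type*} [NormedAddCommGroup E]
    [NormedSpace ℂ E] [NormedAddCommGroup F] [NormedSpace ℂ F] [CompleteSpace F] {f : ι → E → F}
    {b : ι → ℝ} {U : Set E} (hU : IsOpen U) (hb : Summable b)
    (hf : ∀ i, DifferentiableOn ℂ (f i) U) (hfb : ∀ i, ∀ x ∈ U, ‖f i x‖ ≤ b i) :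
    DifferentiableOn ℂ (fun x => ∑' i, f i x) U := fun x hx => by
  obtain ⟨r, hr, h_ball⟩ := Metric.isOpen_iff.mp hU x hx
  have h_half : 0 < r / 2 := half_pos hr
  have h_sub {y : E} (hy : y ∈ ball x (r / 2)) : ball y (r / 2) ⊆ U :=
    (ball_subset_ball' (by linarith [mem_ball.mp hy])).trans h_ball
  have h_cauchy (i : ι) {y : E} (hy : y ∈ ball x (r / 2)) :
      ‖fderiv ℂ (f i) y‖ ≤ 2 * b i / (r / 2) := by
    refine Complex.norm_fderiv_le_div_of_mapsTo_ball ((hf i).mono (h_sub hy)) (fun z hz => ?_)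
      h_half
    rw [mem_closedBall, dist_eq_norm]
    linarith [norm_sub_le (f i z) (f i y), hfb i z (h_sub hy hz),
      hfb i y (h_sub hy (mem_ball_self h_half))]
  have h_diff (i : ι) {y : E} (hy : y ∈ ball x (r / 2)) : HasFDerivAt (f i) (fderiv ℂ (f i) y) y :=
    ((hf i).differentiableAt
      (hU.mem_nhds (h_sub hy (mem_ball_self h_half)))).hasFDerivAt
  have hx_mem : x ∈ ball x (r / 2) := mem_ball_self h_half
  exact (hasFDerivAt_tsum_of_isPreconnected ((hb.mul_left 2).div_const (r / 2)) isOpen_ball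
    (convex_ball x (r / 2)).isPreconnected (fun i y => h_diff i) (fun i y => h_cauchy i) hx_mem
    (.of_norm_bounded hb fun i => hfb i x hx) hx_mem).differentiableAt.differentiableWithinAt

/-- The series of `a_D - τ a` as a function of the moduli `(u, v)` of the curve, in the units
`2ω = 1`; see `modularSum_eq`. -/
noncomputable def modularModuliSum (q : ℂ × ℂ) : ℂ :=
  ∑' p, normTerm q.1 q.2 (recSol (4 * q.1) (-4 * q.2) 0 1) p

lemma modularSum_eq {τ : ℍ} {w : ℂ} (hw : w ≠ 0) :
    modularSum τ w = -(√2 * Real.pi * w)⁻¹ * modularModuliSum (modU τ w, modV τ w) := by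
  rw [modularSum, modularModuliSum, funext (modularTerm_eq_normTerm hw), tsum_mul_left]

lemma differentiable_recSol (a b : ℂ) :
    ∀ n, Differentiable ℂ (fun q : ℂ × ℂ => recSol (4 * q.1) (-4 * q.2) a b n)
  | 0 => by simp only [recSol]; fun_prop
  | 1 => by simp only [recSol]; fun_prop
  | 2 => by simp only [recSol]; fun_prop
  | n + 3 => by
    have h_one := differentiable_recSol a b (n + 1)
    have h_zero := differentiable_recSol a b n
    simp only [recSol]
    fun_prop

lemma differentiable_normTerm {j : ℂ × ℂ → ℕ → ℂ} (hj : ∀ n, Differentiable ℂ fun q => j q n)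
    (p : ℕ × ℕ × ℕ) : Differentiable ℂ fun q : ℂ × ℂ => normTerm q.1 q.2 (j q) p := by
  simp only [normTerm, normCoeff, trinomialTerm]
  fun_prop

lemma differentiableAt_modularModuliSum {q : ℂ × ℂ} (hq : ‖q.1‖ + ‖q.2‖ < 1) :
    DifferentiableAt ℂ modularModuliSum q := by
  obtain ⟨a, ha, hab⟩ : ∃ a, ‖q.1‖ < a ∧ a < 1 - ‖q.2‖ := exists_between (by linarith)
  obtain ⟨b, hb, hab'⟩ : ∃ b, ‖q.2‖ < b ∧ b < 1 - a := exists_between (by linarith)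
  have ha_nonneg : 0 ≤ a := (norm_nonneg _).trans ha.le
  have hb_nonneg : 0 ≤ b := (norm_nonneg _).trans hb.le
  have hU : IsOpen {x : ℂ × ℂ | ‖x.1‖ < a ∧ ‖x.2‖ < b} :=
    (isOpen_lt continuous_fst.norm continuous_const).inter
      (isOpen_lt continuous_snd.norm continuous_const)
  have h_summable : Summable fun p => trinomialTerm (1 / 2) (a / 2) (b / 2) p *
      (4 * max ‖(0 : ℂ)‖ ‖(1 : ℂ)‖) :=
    (summable_trinomialTerm (by norm_num) (by positivity) (by positivity) (by linarith)).mul_right _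
  exact (differentiableOn_tsum_of_summable_norm hU h_summable
    (fun p => (differentiable_normTerm (differentiable_recSol 0 1) p).differentiableOn)
    (fun p x hx => norm_normTerm_le hx.1.le hx.2.le (by linarith)
      (norm_recSol_le (by linarith [hx.1, hx.2]) 0 1) p)).differentiableAt
    (hU.mem_nhds ⟨ha, hb⟩)

section ModularForms

variable {k : ℤ} {F : ℍ → ℂ}

lemma differentiableAt_ofComplex_of_mem_modularFormSubmodule {Γ : Subgroup (GL (Fin 2) ℝ)}
    [Γ.HasDetOne] (hF : F ∈ modularFormSubmodule Γ k) {z : ℂ} (hz : 0 < z.im) :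
    DifferentiableAt ℂ (fun z => F (UpperHalfPlane.ofComplex z)) z := by
  obtain ⟨f, rfl⟩ := hF
  exact (UpperHalfPlane.mdifferentiable_iff.mp (ModularFormClass.holo f)).differentiableAt
    (UpperHalfPlane.isOpen_upperHalfPlaneSet.mem_nhds hz)

lemma smul_eq_of_mem_modularFormSubmodule (hF : F ∈ modularFormSubmodule 𝒮ℒ k) (γ : SL(2, ℤ))
    (τ : ℍ) : F (γ • τ) = UpperHalfPlane.denom γ τ ^ k * F τ := by
  obtain ⟨f, rfl⟩ := hF
  exact SlashInvariantForm.slash_action_eqn'' f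
    (γ := Matrix.SpecialLinearGroup.mapGL ℝ γ) (MonoidHom.mem_range.mpr ⟨γ, rfl⟩) τ

lemma g₂_mem_modularFormSubmodule : g₂ ∈ modularFormSubmodule 𝒮ℒ 4 :=
  mem_modularFormSubmodule_of_mem_eisensteinPolynomial g₂_mem_eisensteinPolynomial

lemma g₃_mem_modularFormSubmodule : g₃ ∈ modularFormSubmodule 𝒮ℒ 6 :=
  mem_modularFormSubmodule_of_mem_eisensteinPolynomial g₃_mem_eisensteinPolynomial

end ModularForms

lemma differentiableAt_modU {p : ℂ × ℂ} (h : 0 < p.1.im) (hw : p.2 ≠ 0) :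
    DifferentiableAt ℂ (fun p : ℂ × ℂ => modU (UpperHalfPlane.ofComplex p.1) p.2) p := by
  have h_g₂ : DifferentiableAt ℂ (fun p : ℂ × ℂ => g₂ (UpperHalfPlane.ofComplex p.1)) p :=
    (differentiableAt_ofComplex_of_mem_modularFormSubmodule g₂_mem_modularFormSubmodule h).comp p
      differentiableAt_fst
  have h_ne : 4 * p.2 ^ 4 ≠ 0 := by simpa using hw
  simp only [modU]
  fun_prop (disch := assumption)

lemma differentiableAt_modV {p : ℂ × ℂ} (h : 0 < p.1.im) (hw : p.2 ≠ 0) :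
    DifferentiableAt ℂ (fun p : ℂ × ℂ => modV (UpperHalfPlane.ofComplex p.1) p.2) p := by
  have h_g₃ : DifferentiableAt ℂ (fun p : ℂ × ℂ => g₃ (UpperHalfPlane.ofComplex p.1)) p :=
    (differentiableAt_ofComplex_of_mem_modularFormSubmodule g₃_mem_modularFormSubmodule h).comp p
      differentiableAt_fst
  have h_ne : 4 * p.2 ^ 6 ≠ 0 := by simpa using hw
  simp only [modV]
  fun_prop (disch := assumption)

lemma mem_domain_iff {p : ℂ × ℂ} :
    p ∈ domain ↔ 0 < p.1.im ∧ InDomain (UpperHalfPlane.ofComplex p.1) p.2 := by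
  refine exists_prop.symm.trans ?_ |>.symm
  refine exists_congr fun h => ?_
  rw [UpperHalfPlane.ofComplex_apply_of_im_pos h]

open Topology in
lemma isOpen_domain : IsOpen domain := by
  rw [isOpen_iff_mem_nhds]
  intro p hp
  obtain ⟨h_im, hw, huv⟩ := mem_domain_iff.mp hp
  have h_norm := ((differentiableAt_modU h_im hw).continuousAt.norm.add
    (differentiableAt_modV h_im hw).continuousAt.norm).eventually_lt continuousAt_const huv
  have h_im_nhds : ∀ᶠ q : ℂ × ℂ in 𝓝 p, 0 < q.1.im :=
    (isOpen_lt continuous_const (by fun_prop)).mem_nhds h_im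
  filter_upwards [h_norm, h_im_nhds, continuousAt_snd.eventually_ne hw] with q hq_norm hq_im hq_ne
  exact mem_domain_iff.mpr ⟨hq_im, hq_ne, hq_norm⟩

lemma differentiableOn_modularSum : DifferentiableOn ℂ
    (fun p : ℂ × ℂ => modularSum (UpperHalfPlane.ofComplex p.1) p.2) domain := by
  suffices h : DifferentiableOn ℂ (fun p : ℂ × ℂ =>
      -(√2 * Real.pi * p.2)⁻¹ * modularModuliSum (modU (UpperHalfPlane.ofComplex p.1) p.2,
        modV (UpperHalfPlane.ofComplex p.1) p.2)) domain from
    h.congr fun p hp => modularSum_eq (mem_domain_iff.mp hp).2.1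
  intro p hp
  obtain ⟨h_im, hw, huv⟩ := mem_domain_iff.mp hp
  have h_sum := DifferentiableAt.comp (g := modularModuliSum) p
    (differentiableAt_modularModuliSum huv)
    ((differentiableAt_modU h_im hw).prodMk (differentiableAt_modV h_im hw))
  have h_ne : √2 * Real.pi * p.2 ≠ 0 := by simpa using hw
  have h_inv : DifferentiableAt ℂ (fun p : ℂ × ℂ => -(√2 * Real.pi * p.2)⁻¹) p := by
    fun_prop (disch := assumption)
  exact (h_inv.fun_mul h_sum).differentiableWithinAt

lemma modU_smul (τ : ℍ) (w : ℂ) (γ : SL(2, ℤ)) :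
    modU (γ • τ) (UpperHalfPlane.denom γ τ * w) = modU τ w := by
  have := UpperHalfPlane.denom_ne_zero γ τ
  rw [modU, modU, smul_eq_of_mem_modularFormSubmodule g₂_mem_modularFormSubmodule, mul_pow,
    zpow_ofNat]
  field_simp

lemma modV_smul (τ : ℍ) (w : ℂ) (γ : SL(2, ℤ)) :
    modV (γ • τ) (UpperHalfPlane.denom γ τ * w) = modV τ w := by
  have := UpperHalfPlane.denom_ne_zero γ τ
  rw [modV, modV, smul_eq_of_mem_modularFormSubmodule g₃_mem_modularFormSubmodule, mul_pow,
    zpow_ofNat]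
  field_simp

section Action

variable {τ : ℍ} {w : ℂ}

lemma InDomain.smul (h : InDomain τ w) (γ : SL(2, ℤ)) :
    InDomain (γ • τ) (UpperHalfPlane.denom γ τ * w) :=
  ⟨mul_ne_zero (UpperHalfPlane.denom_ne_zero γ τ) h.1, by rw [modU_smul, modV_smul]; exact h.2⟩

lemma modularSum_smul (hw : w ≠ 0) (γ : SL(2, ℤ)) :
    modularSum (γ • τ) (UpperHalfPlane.denom γ τ * w) =
      (UpperHalfPlane.denom γ τ)⁻¹ * modularSum τ w := by
  rw [modularSum_eq hw, modularSum_eq (mul_ne_zero (UpperHalfPlane.denom_ne_zero γ τ) hw),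
    modU_smul, modV_smul]
  simp only [mul_inv]
  ring

end Action

end SU3

theorem mainTheorem6 :
    -- the invariants and the parametrisation of the curve
    (∀ τ : ℍ, SU3.g₂ τ = ModularForm.E₄ τ / 12 ∧ SU3.g₃ τ = -ModularForm.E₆ τ / 216) ∧
    (∀ (τ : ℍ) (w z : ℂ), w ≠ 0 → z ∉ (SU3.periods τ).lattice →
      SU3.wp' τ z ^ 2 = 4 * SU3.wp τ z ^ 3 - SU3.g₂ τ * SU3.wp τ z - SU3.g₃ τ ∧
      SU3.smallFactor τ w z = SU3.wp' τ z ^ 2 / (4 * w ^ 6) ∧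
      (SU3.coordX τ w z, SU3.coordY τ w z) ∈ SU3.swCurve (SU3.modU τ w) (SU3.modV τ w)) ∧
    -- the cycle integrals: recursion, initial conditions, expression through `E₂`, `E₄`, `E₆`
    (∀ (τ : ℍ) (γA γB : ℝ → ℂ), SU3.IsACycle τ γA → SU3.IsBCycle τ γB →
      SU3.cycleIntegral τ γA 0 = 1 ∧ SU3.cycleIntegral τ γB 0 = τ ∧
      SU3.Recursion (SU3.g₂ τ) (SU3.g₃ τ) (SU3.cycleIntegral τ γA) ∧
      SU3.Recursion (SU3.g₂ τ) (SU3.g₃ τ) (SU3.cycleIntegral τ γB) ∧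
      ∀ n : ℕ,
        SU3.cycleIntegral τ γA (n + 1) =
          SU3.K (n + 1) τ + EisensteinSeries.E2 τ / 12 * SU3.L n τ ∧
        SU3.cycleIntegral τ γB (n + 1) =
          τ * SU3.cycleIntegral τ γA (n + 1) + 1 / (2 * Real.pi * Complex.I) * SU3.L n τ) ∧
    (∀ n : ℕ,
      (∃ f : ModularForm 𝒮ℒ (2 * n), ∀ τ : ℍ, f τ = SU3.K n τ) ∧
      (∃ f : ModularForm 𝒮ℒ (2 * n), ∀ τ : ℍ, f τ = SU3.L n τ) ∧
      (∃ P : MvPolynomial (Fin 2) ℚ, P.IsWeightedHomogeneous ![4, 6] (2 * n) ∧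
        ∀ τ : ℍ, SU3.K n τ = P.aeval ![ModularForm.E₄ τ, ModularForm.E₆ τ]) ∧
      (∃ P : MvPolynomial (Fin 2) ℚ, P.IsWeightedHomogeneous ![4, 6] (2 * n) ∧
        ∀ τ : ℍ, SU3.L n τ = P.aeval ![ModularForm.E₄ τ, ModularForm.E₆ τ])) ∧
    -- cycles off the branch points exist, and are short cycles for all large `ω`
    (∀ τ : ℍ, ∃ γA γB : ℝ → ℂ, SU3.IsACycle τ γA ∧ SU3.IsBCycle τ γB ∧
      ∀ t ∈ Set.Icc (0 : ℝ) 1, SU3.wp' τ (γA t) ≠ 0 ∧ SU3.wp' τ (γB t) ≠ 0) ∧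
    (∀ (τ : ℍ) (γ : ℝ → ℂ), SU3.IsACycle τ γ ∨ SU3.IsBCycle τ γ →
      (∀ t ∈ Set.Icc (0 : ℝ) 1, SU3.wp' τ (γ t) ≠ 0) →
      ∃ R : ℝ, ∀ w : ℂ, R < ‖w‖ → SU3.InDomain τ w ∧ SU3.IsShort τ w γ) ∧
    -- the expansions of the short periods `a`, `a_D` and of `a_D - τ a`
    (∀ (τ : ℍ) (w : ℂ) (γA γB : ℝ → ℂ), SU3.InDomain τ w →
      SU3.IsACycle τ γA → SU3.IsShort τ w γA → SU3.IsBCycle τ γB → SU3.IsShort τ w γB →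
      SU3.IsClosedPath (SU3.modU τ w) (SU3.modV τ w)
        (fun t => SU3.coordX τ w (γA t)) (fun t => SU3.coordY τ w (γA t)) ∧
      SU3.IsClosedPath (SU3.modU τ w) (SU3.modV τ w)
        (fun t => SU3.coordX τ w (γB t)) (fun t => SU3.coordY τ w (γB t)) ∧
      HasSum (SU3.periodTerm τ w (SU3.cycleIntegral τ γA)) (SU3.shortPeriod τ w γA) ∧
      HasSum (SU3.periodTerm τ w (SU3.cycleIntegral τ γB)) (SU3.shortPeriod τ w γB) ∧
      HasSum (SU3.modularTerm τ w) (SU3.shortPeriod τ w γB - τ * SU3.shortPeriod τ w γA)) ∧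
    -- the series for `a_D - τ a` is holomorphic and modular of weight `-1`
    (∀ (τ : ℍ) (w : ℂ), SU3.InDomain τ w → Summable (SU3.modularTerm τ w)) ∧
    IsOpen SU3.domain ∧
    DifferentiableOn ℂ
      (fun p : ℂ × ℂ => SU3.modularSum (UpperHalfPlane.ofComplex p.1) p.2) SU3.domain ∧
    (∀ (τ : ℍ) (w : ℂ) (γ : SL(2, ℤ)), SU3.InDomain τ w →
      SU3.InDomain (γ • τ) (UpperHalfPlane.denom γ τ * w) ∧
      SU3.modularSum (γ • τ) (UpperHalfPlane.denom γ τ * w) =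
        (UpperHalfPlane.denom γ τ)⁻¹ * SU3.modularSum τ w) := by
  refine ⟨fun τ => ⟨SU3.g₂_eq τ, SU3.g₃_eq τ⟩,
    fun τ w z hw hz => ⟨SU3.wp'_sq hz, SU3.smallFactor_eq hw hz, SU3.coord_mem_swCurve hw hz⟩,
    fun τ γA γB hA hB => ⟨hA.cycleIntegral_zero, hB.cycleIntegral_zero, hA.recursion, hB.recursion,
      fun n => ⟨hA.cycleIntegral_succ n, hB.cycleIntegral_succ hA n⟩⟩,
    fun n => ?_, SU3.exists_isACycle_isBCycle,
    fun τ γ hγ h_ne => hγ.elim (SU3.IsCycle.exists_isShort · h_ne)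
      (SU3.IsCycle.exists_isShort · h_ne),
    fun τ w γA γB hD hA hsA hB hsB =>
      ⟨hA.isClosedPath hD.1 hsA, hB.isClosedPath hD.1 hsB, hA.hasSum_periodTerm hD hsA,
        hB.hasSum_periodTerm hD hsB, SU3.hasSum_modularTerm hD hA hsA hB hsB⟩,
    fun τ w hD => hD.summable_modularTerm, SU3.isOpen_domain, SU3.differentiableOn_modularSum,
    fun τ w γ hD => ⟨hD.smul γ, SU3.modularSum_smul hD.1 γ⟩⟩
  have hK := SU3.K_mem_eisensteinPolynomial n
  have hL := SU3.L_mem_eisensteinPolynomial n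
  exact ⟨SU3.exists_modularForm_eq_of_mem_eisensteinPolynomial hK,
    SU3.exists_modularForm_eq_of_mem_eisensteinPolynomial hL,
    SU3.exists_aeval_eq_of_mem_eisensteinPolynomial hK,
    SU3.exists_aeval_eq_of_mem_eisensteinPolynomial hL⟩
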